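/- For $n\ge 1$ let $\mathbf t_n$ be a uniform random tree on the vertex set $[n]=\{1,\dots,n\}$ (uniform among all labeled trees on $[n]$), and let $\alpha>0$. Consider the following dynamics on the edges of $\mathbf t_n$. Each edge is inflammable, fireproof or burnt; at time $0$ every edge is inflammable. Independently for each edge, an inflammable edge becomes fireproof at rate $1$ and is set on fire at rate $n^{-\alpha}$; when an inflammable edge is set on fire, the fire propagates instantaneously to neighboring inflammable edges and is stopped only by fireproof edges, and every edge that it reaches becomes burnt. Fireproof and burnt edges never change state again, so that eventually every edge is either fireproof or burnt. A vertex is called fireproof if all its adjacent edges are fireproof in the final state. The fireproof forest $\mathcal F_n$ is the graph whose vertices are the fireproof vertices and whose edges are the fireproof edges that join two fireproof vertices; its connected components are called tree-components. Let $U$ and $U'$ be two independent uniform random vertices in $[n]$, independent of $\mathcal F_n$. Then $$\lim_{n\to\infty}\mathbb P\bigl(U \text{ and } U' \text{ are both vertices of } \mathcal F_n \text{ and belong to the same tree-component of } \mathcal F_n\bigr)=\begin{cases}1 & \text{if } \alpha>1/2,\\ 0 & \text{if } \alpha=1/2.\end{cases}$$ -/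

import Mathlib

open MeasureTheory ProbabilityTheory Filter Topology

namespace FireForest

/-- The three states of an edge. -/
inductive EdgeState where
  | inflammable
  | fireproof
  | burnt

/-- A configuration: a state for every edge of the graph `G`. -/
abbrev Config {V : Type*} (G : SimpleGraph V) : Type _ := G.edgeSet → EdgeState

/-- `Spreads G σ e e'`: in the configuration `σ`, a fire started on the edge `e` reaches the edge
`e'`, by passing repeatedly from an edge to an inflammable edge that shares a vertex with it. -/
def Spreads {V : Type*} (G : SimpleGraph V) (σ : Config G) : G.edgeSet → G.edgeSet → Prop :=
  Relation.ReflTransGen fun a b =>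
    (∃ v : V, v ∈ (a : Sym2 V) ∧ v ∈ (b : Sym2 V)) ∧ σ b = EdgeState.inflammable

open Classical in
/-- The effect on a configuration of one ring of a clock. The ring `Sum.inl e` makes `e` fireproof,
the ring `Sum.inr e` sets `e` on fire, and the fire propagates instantaneously. Both have an effect
only if `e` is still inflammable. -/
noncomputable def applyRing {V : Type*} (G : SimpleGraph V) (σ : Config G) :
    G.edgeSet ⊕ G.edgeSet → Config G
  | Sum.inl e =>
      if σ e = EdgeState.inflammable then Function.update σ e EdgeState.fireproof else σ
  | Sum.inr e =>
      if σ e = EdgeState.inflammable then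
        fun e' => if Spreads G σ e e' then EdgeState.burnt else σ e'
      else σ

open Classical in
/-- The rings of all the clocks in chronological order, where `F e` is the time at which the
fireproofing clock of the edge `e` rings, and `I e` the time at which its ignition clock rings.
(One ring of each is enough, since an edge is no longer inflammable after any of them. The order
of simultaneous rings is immaterial: they have probability zero below.) -/
noncomputable def rings {V : Type*} [Fintype V] (G : SimpleGraph V) (F I : G.edgeSet → ℝ) :
    List (G.edgeSet ⊕ G.edgeSet) :=
  (Finset.univ : Finset (G.edgeSet ⊕ G.edgeSet)).toList.mergeSort
    fun a b => decide (Sum.elim F I a ≤ Sum.elim F I b)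

open Classical in
/-- The configuration at time `t`: all edges are inflammable at first, and the rings that occur up
to time `t` act one after the other. -/
noncomputable def configAt {V : Type*} [Fintype V] (G : SimpleGraph V) (F I : G.edgeSet → ℝ)
    (t : ℝ) : Config G :=
  ((rings G F I).filter fun a => decide (Sum.elim F I a ≤ t)).foldl (applyRing G)
    fun _ => EdgeState.inflammable

/-- The edge `e` is fireproof in the final state of the system. -/
def FireproofEdge {V : Type*} [Fintype V] (G : SimpleGraph V) (F I : G.edgeSet → ℝ)
    (e : G.edgeSet) : Prop :=
  ∀ᶠ t in atTop, configAt G F I t e = EdgeState.fireproof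

/-- A vertex is fireproof if all its adjacent edges are fireproof in the final state. -/
def FireproofVertex {V : Type*} [Fintype V] (G : SimpleGraph V) (F I : G.edgeSet → ℝ)
    (v : V) : Prop :=
  ∀ e : G.edgeSet, v ∈ (e : Sym2 V) → FireproofEdge G F I e

/-- The fireproof forest: the fireproof vertices, and the fireproof edges between them. -/
def fireproofForest {V : Type*} [Fintype V] (G : SimpleGraph V) (F I : G.edgeSet → ℝ) :
    G.Subgraph where
  verts := {v | FireproofVertex G F I v}
  Adj u v := (∃ h : G.Adj u v, FireproofEdge G F I ⟨s(u, v), h⟩) ∧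
    FireproofVertex G F I u ∧ FireproofVertex G F I v
  adj_sub h := h.1.1
  edge_vert h := h.2.1
  symm := by
    refine ⟨?_⟩
    rintro u v ⟨⟨h, hf⟩, hu, hv⟩
    refine ⟨⟨h.symm, ?_⟩, hv, hu⟩
    have : (⟨s(v, u), h.symm⟩ : G.edgeSet) = ⟨s(u, v), h⟩ := Subtype.ext Sym2.eq_swap
    rw [this]
    exact hf

/-- The vertices `u` and `v` of `G` both belong to the subgraph `H`, and to the same connected
component of it. -/
def SameComponent {V : Type*} {G : SimpleGraph V} (H : G.Subgraph) (u v : V) : Prop :=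
  ∃ (hu : u ∈ H.verts) (hv : v ∈ H.verts), H.coe.Reachable ⟨u, hu⟩ ⟨v, hv⟩

/-- Every set of graphs is measurable (there are finitely many graphs on `n` vertices). -/
instance graphMeasurableSpace (n : ℕ) : MeasurableSpace (SimpleGraph (Fin n)) := ⊤

/-- All the randomness for size `n`: a graph on the vertex set, the times at which the
fireproofing clocks ring, the times at which the ignition clocks ring, and two vertices. The clocks
are indexed by all pairs of vertices; only those of the edges of the graph are used. -/
abbrev Sample (n : ℕ) : Type :=
  SimpleGraph (Fin n) × (Sym2 (Fin n) → ℝ) × (Sym2 (Fin n) → ℝ) × Fin n × Fin n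

/-- The law of the sample: the graph is a uniform Cayley tree, the fireproofing clocks are
exponential with rate `1`, the ignition clocks are exponential with rate `r`, the two vertices are
uniform, and all of these are independent. -/
noncomputable def law (n : ℕ) (r : ℝ) : Measure (Sample n) :=
  (uniformOn {T : SimpleGraph (Fin n) | T.IsTree}).prod
    ((Measure.pi fun _ => expMeasure 1).prod
      ((Measure.pi fun _ => expMeasure r).prod
        ((uniformOn (Set.univ : Set (Fin n))).prod (uniformOn (Set.univ : Set (Fin n))))))

/-- The fireproof forest of the sampled tree. -/
def sampleForest {n : ℕ} (ω : Sample n) : ω.1.Subgraph :=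
  fireproofForest ω.1 (fun e => ω.2.1 e) (fun e => ω.2.2.1 e)

/-- The event that the two sampled vertices are in the same tree-component of the forest. -/
def connectedEvent (n : ℕ) : Set (Sample n) :=
  {ω | SameComponent (sampleForest ω) ω.2.2.2.1 ω.2.2.2.2}

end FireForest

/-! Root the tree at the second vertex `ρ`, encode it by its parent map `p`, and let `P` be the
vertex set of the path from the first vertex `u` to `ρ`. In a tree, `u` and `ρ` share a component
exactly when all of `P` is fireproof. Identify a vertex with the edge to its parent. This happens if
every `v` outside `P` has, on its way to `P`, an edge whose fireproofing clock rings before the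
ignition clock of `v`, and every edge of the path fireproofs before it ignites
(`sameComponent_of_forall_exists_lt`). Conversely the condition on the vertices outside `P` is
necessary, up to ties (`exists_le_of_sameComponent`). The dynamics then disappear, and only
comparisons of independent exponential clocks remain.

Given `P`, the forest hanging off `P` is uniform among the forests with root set `P`; this is the
content of `sumLevel_succ` and `sumLevel_le`. The number of vertices of the path has the birthday
law `m / n * distinctProb n m`, of order `√n`, and the number `N k` of vertices at distance `k` from
a path of `m` vertices has mean `m * levelMean n m k`, which is at most `m + k`.

For `α > 1/2` a union bound suffices. An ignition clock of rate `r` beats `k` fireproofing clocks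
with probability at most `r / k`, so the failure probability is at most `r` times the mean of `|P| +
∑ N k / k`. After averaging over the path, each mean of `N k` is at most `2 * √n`, uniformly in `k`.
The bound `2 * r * √n * (1 + harmonicSum n)` tends to `0`: the harmonic sum costs only a logarithm.

For `α = 1/2` that same logarithm forces failure. Given the fireproofing clocks, the necessary
condition restricted to depths at most `K` has probability `exp (-r W)`, where `W` sums over these
vertices the minimal clock on the way to `P`. The mean of `W` is close to `|P| * harmonicSum K`.
Distinct trees hanging off `P` contribute independent minima, and a second moment computation on
uniform forests shows that `W` concentrates. Since `r * |P|` is of order `1`, the probability is at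
most `4 / harmonicSum K` plus a term that vanishes as `n → ∞` with `K` fixed; then `K → ∞`. -/

namespace FireForest

/-! ### Counting forests with a prescribed set of roots -/

section RootedForests

variable {V : Type*}

theorem iterate_eq_of_mem {P : Finset V} {h : V → V} (hP : ∀ a ∈ P, h a = a) {v : V} {i j : ℕ}
    (hij : i ≤ j) (hi : h^[i] v ∈ P) : h^[j] v = h^[i] v := by
  obtain ⟨d, rfl⟩ := Nat.exists_eq_add_of_le hij
  rw [add_comm, Function.iterate_add_apply]
  exact Function.iterate_fixed (hP _ hi) d

theorem iterate_unique_of_mem {P : Finset V} {h : V → V} (hP : ∀ a ∈ P, h a = a) {v : V} {i j : ℕ}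
    (hi : h^[i] v ∈ P) (hj : h^[j] v ∈ P) : h^[i] v = h^[j] v := by
  rcases le_total i j with hij | hij
  · exact (iterate_eq_of_mem hP hij hi).symm
  · exact iterate_eq_of_mem hP hij hj

theorem exists_first_iterate {h : V → V} {p : V → Prop} {v : V} (hv : ∃ k, p (h^[k] v)) :
    ∃ k, p (h^[k] v) ∧ ∀ i < k, ¬ p (h^[i] v) := by
  classical
  exact ⟨Nat.find hv, Nat.find_spec hv, fun i hi => Nat.find_min hv hi⟩

theorem iterate_update_eq [DecidableEq V] {h : V → V} {b x v : V} {k : ℕ} (hk : ∀ i < k, h^[i] v ≠ b) :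
    (Function.update h b x)^[k] v = h^[k] v := by
  induction k with
  | zero => rfl
  | succ k ih =>
    rw [Function.iterate_succ_apply', Function.iterate_succ_apply', ih fun i hi => hk i (by omega),
      Function.update_of_ne (hk k (by omega))]

variable [Fintype V]

open Classical in
/-- The number of vertices of the tree of `q`. -/
noncomputable def treeSize (g : V → V) (q : V) : ℕ :=
  (Finset.univ.filter fun x => ∃ j, g^[j] x = q).card

theorem treeSize_conj (g : V → V) (s : Equiv.Perm V) (q : V) :
    treeSize (s ∘ g ∘ s.symm) (s q) = treeSize g q := by
  classical
  unfold treeSize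
  symm
  refine Finset.card_bij (fun x _ => s x) ?_ (fun _ _ _ _ h => s.injective h) ?_
  · intro x hx
    obtain ⟨j, hj⟩ := (Finset.mem_filter.1 hx).2
    have hc : Function.Semiconj s g (s ∘ g ∘ s.symm) := fun x => by simp
    exact Finset.mem_filter.2 ⟨Finset.mem_univ _, j, by rw [← (hc.iterate_right j) x, hj]⟩
  · intro y hy
    obtain ⟨j, hj⟩ := (Finset.mem_filter.1 hy).2
    have hc : Function.Semiconj s g (s ∘ g ∘ s.symm) := fun x => by simp
    refine ⟨s.symm y, Finset.mem_filter.2 ⟨Finset.mem_univ _, j, ?_⟩, by simp⟩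
    apply s.injective
    rw [(hc.iterate_right j) (s.symm y)]; simpa using hj

variable [DecidableEq V]

open Classical in
/-- The maps that fix every element of `P` and all of whose orbits reach `P`: the parent maps of
the forests on `V` with set of roots `P`. -/
noncomputable def rootedForests (P : Finset V) : Finset (V → V) :=
  Finset.univ.filter fun h => (∀ a ∈ P, h a = a) ∧ ∀ v, ∃ k, h^[k] v ∈ P

theorem mem_rootedForests {P : Finset V} {h : V → V} :
    h ∈ rootedForests P ↔ (∀ a ∈ P, h a = a) ∧ ∀ v, ∃ k, h^[k] v ∈ P := by
  simp [rootedForests]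

/-- No vertex outside of `P` is periodic. -/
theorem iterate_succ_ne_self {P : Finset V} {h : V → V} (hh : h ∈ rootedForests P) {b : V}
    (hb : b ∉ P) (j : ℕ) : h^[j + 1] b ≠ b := by
  intro hper
  obtain ⟨hP, hr⟩ := mem_rootedForests.1 hh
  obtain ⟨k, hk⟩ := hr b
  have h1 : h^[(j + 1) * k] b = b := by
    rw [Function.iterate_mul]; exact Function.iterate_fixed hper k
  have h2 : h^[(j + 1) * k] b = h^[k] b :=
    iterate_eq_of_mem hP (Nat.le_mul_of_pos_left k j.succ_pos) hk
  exact hb (by rw [← h1, h2]; exact hk)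

theorem update_self_mem_rootedForests {P : Finset V} {h : V → V} (hh : h ∈ rootedForests P)
    {b : V} : Function.update h b b ∈ rootedForests (insert b P) := by
  obtain ⟨hP, hr⟩ := mem_rootedForests.1 hh
  refine mem_rootedForests.2 ⟨fun a ha => ?_, fun v => ?_⟩
  · by_cases hab : a = b
    · subst hab; simp
    · rw [Function.update_of_ne hab]
      exact hP a ((Finset.mem_insert.1 ha).resolve_left hab)
  · obtain ⟨k, hk, hk'⟩ := exists_first_iterate (h := h) (v := v) (p := fun w => w ∈ insert b P)
      ((hr v).imp fun k hk => Finset.mem_insert_of_mem hk)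
    exact ⟨k, by
      rw [iterate_update_eq fun i hi hb => hk' i hi (hb ▸ Finset.mem_insert_self b P)]; exact hk⟩

/-- Otherwise the orbit of `h b` would return to `b` and close a cycle through a vertex that is not
a root. -/
theorem iterate_update_self_ne {P : Finset V} {h : V → V} (hh : h ∈ rootedForests P)
    {b : V} (hb : b ∉ P) (j : ℕ) : (Function.update h b b)^[j] (h b) ≠ b := by
  intro hj
  obtain ⟨k, hk, hk'⟩ := exists_first_iterate (h := Function.update h b b) (v := h b)
    (p := fun w => w = b) ⟨j, hj⟩
  have h2 : h^[k] (h b) = b := by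
    have h3 := iterate_update_eq (h := Function.update h b b) (b := b) (x := h b) hk'
    rw [Function.update_idem, Function.update_eq_self] at h3
    rw [h3, hk]
  exact iterate_succ_ne_self hh hb k (by rw [Function.iterate_succ_apply]; exact h2)

theorem update_mem_rootedForests {P : Finset V} {b x : V} (hb : b ∉ P) {g : V → V}
    (hg : g ∈ rootedForests (insert b P)) (hx : ∀ j, g^[j] x ≠ b) :
    Function.update g b x ∈ rootedForests P := by
  obtain ⟨hP, hr⟩ := mem_rootedForests.1 hg
  refine mem_rootedForests.2 ⟨fun a ha => ?_, fun v => ?_⟩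
  · rw [Function.update_of_ne (by rintro rfl; exact hb ha)]
    exact hP a (Finset.mem_insert_of_mem ha)
  · obtain ⟨k, hk, hk'⟩ := exists_first_iterate (h := g) (v := v) (p := fun w => w ∈ insert b P)
      (hr v)
    have h1 : (Function.update g b x)^[k] v = g^[k] v :=
      iterate_update_eq fun i hi h => hk' i hi (h ▸ Finset.mem_insert_self b P)
    rcases Finset.mem_insert.1 hk with hkb | hkP
    · obtain ⟨j, hj⟩ := hr x
      refine ⟨j + (k + 1), ?_⟩
      rw [Function.iterate_add_apply, Function.iterate_succ_apply', h1, hkb,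
        Function.update_self, iterate_update_eq fun i _ => hx i]
      exact (Finset.mem_insert.1 hj).resolve_left (hx j)
    · exact ⟨k, h1 ▸ hkP⟩

open Classical in
/-- Forests rooted at `P` in which `x` is the parent of `b` correspond to the forests rooted at
`insert b P` in which `x` is not in the tree of `b`. -/
theorem sum_rootedForests_parent_eq {M : Type*} [AddCommMonoid M] {P : Finset V} {b : V}
    (hb : b ∉ P) (x : V) (f : (V → V) → M) :
    ∑ h ∈ (rootedForests P).filter (fun h => h b = x), f h
      = ∑ g ∈ (rootedForests (insert b P)).filter (fun g => ∀ j, g^[j] x ≠ b),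
          f (Function.update g b x) := by
  refine Finset.sum_nbij' (fun h => Function.update h b b) (fun g => Function.update g b x)
    ?_ ?_ ?_ ?_ ?_
  · intro h hh
    obtain ⟨h1, h2⟩ := Finset.mem_filter.1 hh
    refine Finset.mem_filter.2 ⟨update_self_mem_rootedForests h1, fun j => ?_⟩
    rw [← h2]; exact iterate_update_self_ne h1 hb j
  · intro g hg
    obtain ⟨h1, h2⟩ := Finset.mem_filter.1 hg
    exact Finset.mem_filter.2 ⟨update_mem_rootedForests hb h1 h2, by simp⟩
  · intro h hh
    obtain ⟨h1, h2⟩ := Finset.mem_filter.1 hh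
    rw [← h2]; simp
  · intro g hg
    obtain ⟨h1, h2⟩ := Finset.mem_filter.1 hg
    have := (mem_rootedForests.1 h1).1 b (Finset.mem_insert_self b P)
    conv_rhs => rw [← Function.update_eq_self b g, this]
    simp
  · intro h hh
    obtain ⟨h1, h2⟩ := Finset.mem_filter.1 hh
    rw [← h2]; simp

theorem sum_treeSize {P : Finset V} {g : V → V} (hg : g ∈ rootedForests P) :
    ∑ q ∈ P, treeSize g q = Fintype.card V := by
  classical
  obtain ⟨hP, hr⟩ := mem_rootedForests.1 hg
  unfold treeSize
  rw [← Finset.card_biUnion, ← Finset.card_univ]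
  · congr 1
    ext x
    simp only [Finset.mem_biUnion, Finset.mem_filter, Finset.mem_univ, true_and, iff_true]
    obtain ⟨k, hk⟩ := hr x
    exact ⟨_, hk, k, rfl⟩
  · intro q hq q' hq' hne
    refine Finset.disjoint_left.2 ?_
    intro x hx hx'
    obtain ⟨i, rfl⟩ := (Finset.mem_filter.1 hx).2
    obtain ⟨j, rfl⟩ := (Finset.mem_filter.1 hx').2
    exact hne (iterate_unique_of_mem hP hq hq')

theorem conj_mem_rootedForests {P : Finset V} {g : V → V} (hg : g ∈ rootedForests P)
    (s : Equiv.Perm V) (hs : ∀ a, s a ∈ P ↔ a ∈ P) (hs' : ∀ a, s.symm a ∈ P ↔ a ∈ P) :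
    s ∘ g ∘ s.symm ∈ rootedForests P := by
  obtain ⟨hP, hr⟩ := mem_rootedForests.1 hg
  refine mem_rootedForests.2 ⟨fun a ha => ?_, fun v => ?_⟩
  · simp [hP _ ((hs' a).2 ha)]
  · obtain ⟨k, hk⟩ := hr (s.symm v)
    refine ⟨k, ?_⟩
    have : (s ∘ g ∘ s.symm)^[k] v = s (g^[k] (s.symm v)) := by
      have hc : Function.Semiconj s g (s ∘ g ∘ s.symm) := fun x => by simp
      have := (hc.iterate_right k) (s.symm v)
      simpa using this.symm
    rw [this]; exact (hs _).2 hk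

/-- Roots are exchangeable. -/
theorem sum_treeSize_eq {P : Finset V} {q q' : V} (hq : q ∈ P) (hq' : q' ∈ P) :
    ∑ g ∈ rootedForests P, treeSize g q = ∑ g ∈ rootedForests P, treeSize g q' := by
  have hmem : ∀ a, Equiv.swap q q' a ∈ P ↔ a ∈ P := by
    intro a
    by_cases h1 : a = q
    · subst h1; simp [hq, hq']
    · by_cases h2 : a = q'
      · subst h2; simp [hq, hq']
      · rw [Equiv.swap_apply_of_ne_of_ne h1 h2]
  refine Finset.sum_nbij' (fun g => Equiv.swap q q' ∘ g ∘ (Equiv.swap q q').symm)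
    (fun g => Equiv.swap q q' ∘ g ∘ (Equiv.swap q q').symm) ?_ ?_ ?_ ?_ ?_
  · intro g hg; exact conj_mem_rootedForests hg _ hmem (by simpa using hmem)
  · intro g hg; exact conj_mem_rootedForests hg _ hmem (by simpa using hmem)
  · intro g _; ext; simp
  · intro g _; ext; simp
  · intro g _
    have := treeSize_conj g (Equiv.swap q q') q
    rw [Equiv.swap_apply_left] at this
    exact this.symm

theorem card_mul_sum_treeSize {P : Finset V} {q : V} (hq : q ∈ P) :
    P.card * ∑ g ∈ rootedForests P, treeSize g q = (rootedForests P).card * Fintype.card V := by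
  have h1 : ∑ q' ∈ P, ∑ g ∈ rootedForests P, treeSize g q'
      = P.card * ∑ g ∈ rootedForests P, treeSize g q := by
    rw [Finset.sum_congr rfl fun q' hq' => sum_treeSize_eq hq' hq]; simp
  rw [← h1, Finset.sum_comm, Finset.sum_congr rfl fun g hg => sum_treeSize hg]
  simp

/-- Give the root `b` a parent: any vertex outside the tree of `b` is allowed. By exchangeability of
the roots this tree has average size `n / (m + 1)`, where `m = P.card`, so a forest with `m + 1`
roots allows on average `n * m / (m + 1)` parents. Iterated, this is the only enumeration of forests
that is needed. -/
theorem card_rootedForests_insert {P : Finset V} {b : V} (hb : b ∉ P) :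
    P.card * Fintype.card V * (rootedForests (insert b P)).card
      = (P.card + 1) * (rootedForests P).card := by
  classical
  have h1 : (rootedForests P).card + ∑ g ∈ rootedForests (insert b P), treeSize g b
      = Fintype.card V * (rootedForests (insert b P)).card := by
    have h2 : (rootedForests P).card
        = ∑ x : V, ∑ h ∈ (rootedForests P).filter (fun h => h b = x), 1 := by
      rw [Finset.card_eq_sum_ones]
      exact (Finset.sum_fiberwise _ (fun h : V → V => h b) _).symm
    have h3 : ∀ x : V, ∑ h ∈ (rootedForests P).filter (fun h => h b = x), 1
        = ∑ g ∈ rootedForests (insert b P), if ∀ j, g^[j] x ≠ b then 1 else 0 := by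
      intro x
      rw [sum_rootedForests_parent_eq hb x, Finset.sum_filter]
    rw [h2, Finset.sum_congr rfl fun x _ => h3 x, Finset.sum_comm, ← Finset.sum_add_distrib]
    have h4 : ∀ g : V → V, ((∑ x : V, if ∀ j, g^[j] x ≠ b then 1 else 0) + treeSize g b)
        = Fintype.card V := by
      intro g
      rw [← Finset.card_univ, ← Finset.card_filter_add_card_filter_not (s := Finset.univ)
        (fun x => ∃ j, g^[j] x = b), add_comm, treeSize, ← Finset.card_filter]
      congr 2
      ext x; simp
    rw [Finset.sum_congr rfl fun g _ => h4 g]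
    simp [mul_comm]
  have h5 := card_mul_sum_treeSize (Finset.mem_insert_self b P)
  rw [Finset.card_insert_of_notMem hb] at h5
  have h6 := congrArg ((P.card + 1) * ·) h1
  simp only [mul_add, h5] at h6
  nlinarith

end RootedForests

/-! ### Conditioning on a path: the forest off the path is uniform -/

section Levels

variable {V : Type*} [DecidableEq V]

/-- The forest obtained from `h` by turning all the vertices of `Q` into roots. -/
def freeze (h : V → V) (Q : Finset V) : V → V := fun v => if v ∈ Q then v else h v

theorem freeze_update {h : V → V} {b : V} {Q : Finset V} (hb : b ∈ Q) :
    freeze (Function.update h b b) Q = freeze h Q := by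
  ext v
  unfold freeze
  split_ifs with hv
  · rfl
  · rw [Function.update_of_ne (by rintro rfl; exact hv hb)]

variable [Fintype V]

open Classical in
/-- The vertices that reach `P` in exactly `k` steps, and at `q`. -/
noncomputable def level (P : Finset V) (h : V → V) (q : V) (k : ℕ) : Finset V :=
  Finset.univ.filter fun v => h^[k] v = q ∧ ∀ i < k, h^[i] v ∉ P

open Classical in
/-- The roots `P` together with the orbit of `v`. -/
noncomputable def addOrbit (P : Finset V) (h : V → V) (v : V) : Finset V :=
  P ∪ Finset.univ.filter fun w => ∃ i, h^[i] v = w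

theorem mem_level {P : Finset V} {h : V → V} {q v : V} {k : ℕ} :
    v ∈ level P h q k ↔ h^[k] v = q ∧ ∀ i < k, h^[i] v ∉ P := by
  simp [level]

theorem mem_addOrbit {P : Finset V} {h : V → V} {v w : V} :
    w ∈ addOrbit P h v ↔ w ∈ P ∨ ∃ i, h^[i] v = w := by
  simp [addOrbit]

/-- Here `b` is the last vertex on the way from `v` to the root `q`. Once `b` is cut off and becomes
a root, `v` lies one level lower. -/
theorem level_succ_filter {P : Finset V} {h : V → V} (hh : h ∈ rootedForests P) {q b : V}
    (hq : q ∈ P) (hb : b ∉ P) (hbq : h b = q) (k : ℕ) :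
    (level P h q (k + 1)).filter (fun v => h^[k] v = b)
      = level (insert b P) (Function.update h b b) b k := by
  obtain ⟨hP, hr⟩ := mem_rootedForests.1 hh
  ext v
  rw [Finset.mem_filter, mem_level, mem_level]
  constructor
  · rintro ⟨⟨h1, h2⟩, h3⟩
    have h4 : ∀ i < k, h^[i] v ≠ b := by
      intro i hi hib
      refine h2 (i + 1) (by omega) ?_
      rw [Function.iterate_succ_apply', hib, hbq]; exact hq
    refine ⟨(iterate_update_eq h4).trans h3, fun i hi => ?_⟩
    rw [iterate_update_eq fun j hj => h4 j (by omega), Finset.mem_insert, not_or]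
    exact ⟨h4 i hi, h2 i (by omega)⟩
  · rintro ⟨h1, h2⟩
    have h4 : ∀ i ≤ k, h^[i] v = (Function.update h b b)^[i] v := by
      intro i hi
      have := iterate_update_eq (h := Function.update h b b) (b := b) (x := h b) (v := v) (k := i)
        (fun j hj hjb => h2 j (by omega) (by rw [hjb]; exact Finset.mem_insert_self b P))
      rwa [Function.update_idem, Function.update_eq_self] at this
    have h5 : h^[k] v = b := (h4 k le_rfl).trans h1
    refine ⟨⟨?_, fun i hi => ?_⟩, h5⟩
    · rw [Function.iterate_succ_apply', h5, hbq]
    · rcases Nat.lt_succ_iff_lt_or_eq.1 hi with hi | rfl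
      · rw [h4 i hi.le]
        exact fun hP => h2 i hi (Finset.mem_insert_of_mem hP)
      · rwa [h5]

theorem level_iterate_ne {P : Finset V} {h : V → V} {b v : V} {k : ℕ}
    (hv : v ∈ level (insert b P) (Function.update h b b) b k) :
    ∀ i ≤ k, (Function.update h b b)^[i] v = h^[i] v := by
  intro i hi
  have := iterate_update_eq (h := Function.update h b b) (b := b) (x := h b) (v := v) (k := i)
    (fun j hj hjb => (mem_level.1 hv).2 j (by omega)
      (by rw [hjb]; exact Finset.mem_insert_self b P))
  rw [Function.update_idem, Function.update_eq_self] at this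
  exact this.symm

/-- After the cut the orbit of `v` stops at `b` instead of `q`, but both are roots of the new
forest, so roots and path together form the same set. -/
theorem addOrbit_update {P : Finset V} {h : V → V} (hh : h ∈ rootedForests P) {q b v : V} {k : ℕ}
    (hq : q ∈ P) (hbq : h b = q)
    (hv : v ∈ level (insert b P) (Function.update h b b) b k) :
    addOrbit (insert b P) (Function.update h b b) v = addOrbit P h v := by
  obtain ⟨hP, hr⟩ := mem_rootedForests.1 hh
  have h1 := level_iterate_ne hv
  have h2 := (mem_level.1 hv).1
  ext w
  rw [mem_addOrbit, mem_addOrbit, Finset.mem_insert]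
  constructor
  · rintro ((rfl | hw) | ⟨i, rfl⟩)
    · exact Or.inr ⟨k, by rw [← h1 k le_rfl, h2]⟩
    · exact Or.inl hw
    · rcases le_total i k with hik | hik
      · exact Or.inr ⟨i, (h1 i hik).symm⟩
      · refine Or.inr ⟨k, ?_⟩
        obtain ⟨d, rfl⟩ := Nat.exists_eq_add_of_le hik
        rw [← h1 k le_rfl, add_comm, Function.iterate_add_apply, h2]
        exact (Function.iterate_fixed (by simp) d).symm
  · rintro (hw | ⟨i, rfl⟩)
    · exact Or.inl (Or.inr hw)
    · rcases le_or_gt i k with hik | hik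
      · exact Or.inr ⟨i, h1 i hik⟩
      · refine Or.inl (Or.inr ?_)
        have h3 : h^[k + 1] v = q := by
          rw [Function.iterate_succ_apply', ← h1 k le_rfl, h2, hbq]
        rw [iterate_eq_of_mem hP (i := k + 1) hik (by rw [h3]; exact hq), h3]
        exact hq

/-- The sum over all the forests with roots `P`, and over all vertices `v` at depth `k` in the tree
of `q`, of a function of the forest in which the path from `v` to its root is frozen. -/
noncomputable def sumLevel (P : Finset V) (q : V) (k : ℕ) (Ξ : Finset V → (V → V) → ℝ) : ℝ :=
  ∑ h ∈ rootedForests P, ∑ v ∈ level P h q k, Ξ (addOrbit P h v) (freeze h (addOrbit P h v))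

theorem sumLevel_zero {P : Finset V} {q : V} (hq : q ∈ P) (Ξ : Finset V → (V → V) → ℝ) :
    sumLevel P q 0 Ξ = ∑ h ∈ rootedForests P, Ξ P h := by
  refine Finset.sum_congr rfl fun h hh => ?_
  obtain ⟨hP, hr⟩ := mem_rootedForests.1 hh
  have h1 : level P h q 0 = {q} := by ext v; simp [mem_level]
  have h2 : addOrbit P h q = P := by
    ext w
    rw [mem_addOrbit, or_iff_left_iff_imp]
    rintro ⟨i, rfl⟩
    rw [Function.iterate_fixed (hP q hq)]; exact hq
  have h3 : freeze h P = h := by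
    ext v
    unfold freeze
    split_ifs with hv
    · exact (hP v hv).symm
    · rfl
  rw [h1, Finset.sum_singleton, h2, h3]

/-- Sum over the child `b` of `q` through which the path arrives and turn `b` into a root. Since `b`
is frozen on both sides, the summand is unchanged. Iterating, the whole path becomes roots and a
plain sum over uniform forests is left. -/
theorem sumLevel_succ {P : Finset V} {q : V} (hq : q ∈ P) (k : ℕ)
    (Ξ : Finset V → (V → V) → ℝ) :
    sumLevel P q (k + 1) Ξ = ∑ b ∈ Pᶜ, sumLevel (insert b P) b k Ξ := by
  classical
  set f : (V → V) → V → ℝ := fun h v => Ξ (addOrbit P h v) (freeze h (addOrbit P h v)) with hf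
  have h1 : ∀ h ∈ rootedForests P, ∑ v ∈ level P h q (k + 1), f h v
      = ∑ b ∈ Pᶜ, if h b = q then
          ∑ v ∈ level (insert b P) (Function.update h b b) b k, f h v else 0 := by
    intro h hh
    rw [← Finset.sum_filter, ← Finset.sum_fiberwise_of_maps_to (g := fun v => h^[k] v)
      (t := Pᶜ.filter fun b => h b = q)]
    · refine Finset.sum_congr rfl fun b hb => ?_
      obtain ⟨hb1, hb2⟩ := Finset.mem_filter.1 hb
      rw [level_succ_filter hh hq (Finset.mem_compl.1 hb1) hb2]
    · intro v hv
      obtain ⟨hv1, hv2⟩ := mem_level.1 hv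
      rw [Function.iterate_succ_apply'] at hv1
      exact Finset.mem_filter.2 ⟨Finset.mem_compl.2 (hv2 k (by omega)), hv1⟩
  unfold sumLevel
  rw [Finset.sum_congr rfl h1, Finset.sum_comm]
  refine Finset.sum_congr rfl fun b hb => ?_
  have hbP := Finset.mem_compl.1 hb
  -- The condition that `q` is not in the tree of `b` is vacuous, because `q` is itself a root.
  rw [← Finset.sum_filter, sum_rootedForests_parent_eq hbP q, Finset.filter_true_of_mem]
  · refine Finset.sum_congr rfl fun g hg => ?_
    have hgb := (mem_rootedForests.1 hg).1 b (Finset.mem_insert_self b P)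
    have hgq := (mem_rootedForests.1 hg).1 q (Finset.mem_insert_of_mem hq)
    have h2 : Function.update (Function.update g b q) b b = g := by
      rw [Function.update_idem]
      conv_rhs => rw [← Function.update_eq_self b g, hgb]
    have h4 : ∀ j, g^[j] q ≠ b := fun j => by
      rw [Function.iterate_fixed hgq]; rintro rfl; exact hbP hq
    have h3 := update_mem_rootedForests hbP hg h4
    rw [h2]
    refine Finset.sum_congr rfl fun v hv => ?_
    have h5 := addOrbit_update h3 (q := q) (b := b) (v := v) (k := k) hq (by simp)
      (by rw [h2]; exact hv)
    rw [h2] at h5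
    rw [hf]
    simp only
    rw [← h5]
    congr 1
    have := freeze_update (h := Function.update g b q) (b := b)
      (Q := addOrbit (insert b P) g v) (mem_addOrbit.2 (Or.inl (Finset.mem_insert_self b P)))
    rw [h2] at this
    exact this.symm
  · intro g hg j
    have hgq := (mem_rootedForests.1 hg).1 q (Finset.mem_insert_of_mem hq)
    rw [Function.iterate_fixed hgq]; rintro rfl; exact hbP hq

/-- The expected number of vertices at depth `k` in a given tree of a uniform forest with `m` roots
on `n` vertices. -/
noncomputable def levelMean (n m k : ℕ) : ℝ :=
  ((n - m).descFactorial k : ℝ) * (m + k) / (m * (n : ℝ) ^ k)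

theorem levelMean_zero {n m : ℕ} (hm : 0 < m) : levelMean n m 0 = 1 := by
  have : (m : ℝ) ≠ 0 := by positivity
  simp [levelMean, this]

theorem levelMean_nonneg (n m k : ℕ) : 0 ≤ levelMean n m k := by
  unfold levelMean; positivity

theorem levelMean_succ {n m k : ℕ} (hm : 0 < m) (hn : 0 < n) :
    levelMean n m (k + 1) = ((n - m : ℕ) : ℝ) * ((m + 1) / (m * n)) * levelMean n (m + 1) k := by
  have h1 : (m : ℝ) ≠ 0 := by positivity
  have h2 : (n : ℝ) ≠ 0 := by positivity
  have h3 : (m : ℝ) + 1 ≠ 0 := by positivity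
  rcases Nat.eq_zero_or_pos (n - m) with h | h
  · simp [levelMean, h]
  · obtain ⟨d, hd⟩ := Nat.exists_eq_add_of_lt h
    have h4 : n - (m + 1) = d := by omega
    have h5 : n - m = d + 1 := by omega
    unfold levelMean
    rw [h4, h5, Nat.succ_descFactorial_succ]
    push_cast
    field_simp
    ring

theorem levelMean_le {n m k : ℕ} (hm : 0 < m) : levelMean n m k ≤ (m + k) / m := by
  have h1 : (0 : ℝ) < m := by positivity
  rcases Nat.eq_zero_or_pos n with rfl | hn
  · rcases Nat.eq_zero_or_pos k with rfl | hk
    · rw [levelMean_zero hm]; simp [h1.ne']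
    · have : levelMean 0 m k = 0 := by simp [levelMean, hk.ne']
      rw [this]; positivity
  · have h2 : ((n - m).descFactorial k : ℝ) ≤ (n : ℝ) ^ k := by
      have := (Nat.descFactorial_le_pow (n - m) k).trans (Nat.pow_le_pow_left (Nat.sub_le n m) k)
      exact_mod_cast this
    have h3 : (0 : ℝ) < (n : ℝ) ^ k := by positivity
    unfold levelMean
    rw [div_le_div_iff₀ (by positivity) h1]
    have : (0 : ℝ) ≤ (m + k) * m := by positivity
    nlinarith

theorem card_rootedForests_insert_real {P : Finset V} {b : V} (hb : b ∉ P) (hP : P.Nonempty) :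
    ((rootedForests (insert b P)).card : ℝ)
      = (P.card + 1) / (P.card * Fintype.card V) * (rootedForests P).card := by
  have h1 := card_rootedForests_insert hb
  have h2 : (0 : ℝ) < P.card := by exact_mod_cast hP.card_pos
  have h3 : (0 : ℝ) < Fintype.card V := by exact_mod_cast Fintype.card_pos_iff.2 ⟨b⟩
  have h4 : (P.card * Fintype.card V * (rootedForests (insert b P)).card : ℝ)
      = (P.card + 1) * (rootedForests P).card := by exact_mod_cast h1
  field_simp
  linarith

/-- After `k` cuts the roots form a set `Q` of size `P.card + k`. The factor `levelMean` collects
the `(n - m).descFactorial k` choices of the path and the ratio `(m + k) / (m * n ^ k)` of the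
numbers of forests. So an average bound `B` over uniform forests rooted at `Q` transfers to the part
of the forest off the path. -/
theorem sumLevel_le {P : Finset V} {q : V} (hq : q ∈ P) {k : ℕ} {Ξ : Finset V → (V → V) → ℝ}
    {B : ℝ} (hB : ∀ Q, P ⊆ Q → Q.card = P.card + k →
      ∑ h ∈ rootedForests Q, Ξ Q h ≤ (rootedForests Q).card * B) :
    sumLevel P q k Ξ
      ≤ (rootedForests P).card * (levelMean (Fintype.card V) P.card k * B) := by
  have hn : 0 < Fintype.card V := Fintype.card_pos_iff.2 ⟨q⟩
  induction k generalizing P q with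
  | zero =>
    rw [sumLevel_zero hq, levelMean_zero (Finset.card_pos.2 ⟨q, hq⟩), one_mul]
    exact hB P subset_rfl rfl
  | succ k ih =>
    rw [sumLevel_succ hq]
    have hm : 0 < P.card := Finset.card_pos.2 ⟨q, hq⟩
    calc ∑ b ∈ Pᶜ, sumLevel (insert b P) b k Ξ
        ≤ ∑ b ∈ Pᶜ, (P.card + 1) / (P.card * Fintype.card V) * ((rootedForests P).card
            * (levelMean (Fintype.card V) (P.card + 1) k * B)) := by
          refine Finset.sum_le_sum fun b hb => ?_
          have hbP := Finset.mem_compl.1 hb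
          have h1 := ih (Finset.mem_insert_self b P) (fun Q hQ hc => hB Q
            ((Finset.subset_insert b P).trans hQ)
            (by rw [hc, Finset.card_insert_of_notMem hbP]; ring))
          rw [card_rootedForests_insert_real hbP ⟨q, hq⟩, Finset.card_insert_of_notMem hbP,
            mul_assoc] at h1
          exact h1
      _ = _ := by
          rw [Finset.sum_const, Finset.card_compl, levelMean_succ hm hn, nsmul_eq_mul]
          ring

/-- The upper bound `sumLevel_le` holds for signed functions, so applying it to the constants `1`
and `-1` gives an equality. -/
theorem sum_card_level {P : Finset V} {q : V} (hq : q ∈ P) (k : ℕ) :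
    ∑ h ∈ rootedForests P, ((level P h q k).card : ℝ)
      = (rootedForests P).card * levelMean (Fintype.card V) P.card k := by
  have h1 := sumLevel_le hq (k := k) (Ξ := fun _ _ => 1) (B := 1) (fun Q _ _ => by simp)
  have h2 := sumLevel_le hq (k := k) (Ξ := fun _ _ => -1) (B := -1) (fun Q _ _ => by simp)
  simp only [sumLevel, Finset.sum_const, nsmul_eq_mul, mul_one, mul_neg, Finset.sum_neg_distrib]
    at h1 h2
  linarith

end Levels

/-! ### Second moments of the level sizes -/

section SecondMoment

variable {V : Type*} [DecidableEq V]

theorem iterate_freeze {h : V → V} {Q : Finset V} {v : V} {k : ℕ}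
    (hk : ∀ i < k, h^[i] v ∉ Q) : (freeze h Q)^[k] v = h^[k] v := by
  induction k with
  | zero => rfl
  | succ k ih =>
    rw [Function.iterate_succ_apply', Function.iterate_succ_apply', ih fun i hi => hk i (by omega),
      freeze, if_neg (hk k (by omega))]

variable [Fintype V]

/-- Freezing a path inside the tree of `q` does not touch the tree of another root `q'`. -/
theorem level_subset_level_freeze {P : Finset V} {h : V → V} (hh : h ∈ rootedForests P)
    {q q' v : V} {k : ℕ} (hq : q ∈ P) (hq' : q' ∈ P) (hne : q' ≠ q) (hv : v ∈ level P h q k)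
    (j : ℕ) :
    level P h q' j ⊆ level (addOrbit P h v) (freeze h (addOrbit P h v)) q' j := by
  obtain ⟨hP, hr⟩ := mem_rootedForests.1 hh
  obtain ⟨hv1, hv2⟩ := mem_level.1 hv
  intro w hw
  obtain ⟨hw1, hw2⟩ := mem_level.1 hw
  have h1 : ∀ i < j, h^[i] w ∉ addOrbit P h v := by
    intro i hi hmem
    rcases mem_addOrbit.1 hmem with h1 | ⟨s, hs⟩
    · exact hw2 i hi h1
    · have h2 : h^[(j - i) + s] v = q' := by
        rw [Function.iterate_add_apply, hs, ← Function.iterate_add_apply, Nat.sub_add_cancel hi.le,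
          hw1]
      refine hne ?_
      rw [← h2, ← hv1]
      exact iterate_unique_of_mem hP (by rw [h2]; exact hq') (by rw [hv1]; exact hq)
  refine mem_level.2 ⟨by rw [iterate_freeze h1, hw1], fun i hi => ?_⟩
  rw [iterate_freeze fun s hs => h1 s (by omega)]
  exact h1 i hi

/-- Within the tree of `q` itself, a vertex at depth `j` first meets the frozen set after some `i ≤
j` steps, at `q` or at one of the new roots. -/
theorem card_level_le_freeze {P Q : Finset V} {h : V → V} {q : V} (hPQ : P ⊆ Q) (hq : q ∈ P)
    (j : ℕ) :
    (level P h q j).card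
      ≤ ∑ i ∈ Finset.range (j + 1), ∑ s ∈ Q \ P.erase q, (level Q (freeze h Q) s i).card := by
  classical
  have h1 : level P h q j ⊆ (Finset.range (j + 1)).biUnion fun i =>
      (Q \ P.erase q).biUnion fun s => level Q (freeze h Q) s i := by
    intro w hw
    obtain ⟨hw1, hw2⟩ := mem_level.1 hw
    obtain ⟨i, hi, hi'⟩ := exists_first_iterate (h := h) (v := w) (p := fun x => x ∈ Q)
      ⟨j, by rw [hw1]; exact hPQ hq⟩
    have hij : i ≤ j := by
      by_contra hlt
      exact hi' j (by omega) (by rw [hw1]; exact hPQ hq)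
    simp only [Finset.mem_biUnion, Finset.mem_range, Finset.mem_sdiff]
    refine ⟨i, by omega, h^[i] w, ⟨hi, fun hmem => ?_⟩, mem_level.2 ⟨iterate_freeze hi', ?_⟩⟩
    · obtain ⟨h1, h2⟩ := Finset.mem_erase.1 hmem
      rcases hij.lt_or_eq with hlt | rfl
      · exact hw2 i hlt h2
      · exact h1 hw1
    · intro s hs
      rw [iterate_freeze fun t ht => hi' t (by omega)]
      exact hi' s hs
  exact (Finset.card_le_card h1).trans (Finset.card_biUnion_le.trans
    (Finset.sum_le_sum fun i _ => Finset.card_biUnion_le))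

/-- The device for second moments: one factor chooses a vertex `v` at depth `k`, the other is
controlled by the forest in which the path of `v` is frozen, and that forest is uniform. -/
theorem sum_card_level_mul_le {P : Finset V} {q : V} (hq : q ∈ P) (k : ℕ)
    {φ : (V → V) → ℝ} {Ξ : Finset V → (V → V) → ℝ} {B : ℝ}
    (hφ : ∀ h ∈ rootedForests P, ∀ v ∈ level P h q k,
      φ h ≤ Ξ (addOrbit P h v) (freeze h (addOrbit P h v)))
    (hB : ∀ Q, P ⊆ Q → Q.card = P.card + k →
      ∑ h ∈ rootedForests Q, Ξ Q h ≤ (rootedForests Q).card * B) :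
    ∑ h ∈ rootedForests P, ((level P h q k).card : ℝ) * φ h
      ≤ (rootedForests P).card * (levelMean (Fintype.card V) P.card k * B) := by
  refine le_trans ?_ (sumLevel_le hq hB)
  refine Finset.sum_le_sum fun h hh => ?_
  rw [← nsmul_eq_mul, ← Finset.sum_const]
  exact Finset.sum_le_sum fun v hv => hφ h hh v hv

/-- The leading term `P.card ^ 2` must have constant `1`: it has to cancel against the squared mean,
leaving a variance that is linear in `P.card` up to a factor depending on `K`. -/
theorem sum_card_level_mul_ne_le (P : Finset V) (k j : ℕ) :
    ∑ h ∈ rootedForests P, ∑ q ∈ P, ∑ q' ∈ P.erase q,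
        ((level P h q k).card : ℝ) * (level P h q' j).card
      ≤ (rootedForests P).card * ((P.card : ℝ) * (P.card + k + j)) := by
  rw [Finset.sum_comm]
  set m := P.card with hm
  have key : ∀ q ∈ P, ∑ h ∈ rootedForests P, ∑ q' ∈ P.erase q,
      ((level P h q k).card : ℝ) * (level P h q' j).card
      ≤ (rootedForests P).card * ((m : ℝ) + k + j) := by
    intro q hq
    have hm0 : 0 < m := Finset.card_pos.2 ⟨q, hq⟩
    have hmR : (0 : ℝ) < m := by exact_mod_cast hm0
    have h1 := sum_card_level_mul_le hq k
      (φ := fun h => ∑ q' ∈ P.erase q, ((level P h q' j).card : ℝ))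
      (Ξ := fun Q g => ∑ q' ∈ P.erase q, ((level Q g q' j).card : ℝ))
      -- There are `m - 1` other trees, now seen in a forest with `m + k` roots.
      (B := (m - 1) * levelMean (Fintype.card V) (m + k) j)
      (fun h hh v hv => Finset.sum_le_sum fun q' hq' => by
        have := Finset.card_le_card (level_subset_level_freeze hh hq
          (Finset.mem_of_mem_erase hq') (Finset.ne_of_mem_erase hq') hv j)
        exact_mod_cast this)
      (fun Q hQ hc => by
        rw [Finset.sum_comm, Finset.sum_congr rfl fun q' hq' =>
          sum_card_level (hQ (Finset.mem_of_mem_erase hq')) j, Finset.sum_const,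
          Finset.card_erase_of_mem hq, nsmul_eq_mul, hc, ← hm, Nat.cast_sub hm0]
        apply le_of_eq; push_cast; ring)
    simp only [Finset.mul_sum] at h1
    refine h1.trans ?_
    refine mul_le_mul_of_nonneg_left ?_ (Nat.cast_nonneg _)
    have h2 := levelMean_le (n := Fintype.card V) (k := k) hm0
    have h3 := levelMean_le (n := Fintype.card V) (m := m + k) (k := j) (by omega)
    have h4 : (0 : ℝ) ≤ (m : ℝ) - 1 := by
      have : (1 : ℝ) ≤ m := by exact_mod_cast hm0
      linarith
    calc levelMean (Fintype.card V) m k * ((m - 1) * levelMean (Fintype.card V) (m + k) j)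
        ≤ ((m + k) / m) * (m * (((m + k : ℕ) + j) / (m + k : ℕ))) := by
          gcongr
          · exact mul_nonneg h4 (levelMean_nonneg _ _ _)
          · exact levelMean_nonneg _ _ _
          · linarith
      _ = m + k + j := by
          push_cast
          have : (m : ℝ) + k ≠ 0 := by positivity
          field_simp
  refine (Finset.sum_le_sum key).trans ?_
  rw [Finset.sum_const, nsmul_eq_mul]
  apply le_of_eq; ring

theorem levelMean_le_of_le {n m k K : ℕ} (hm : 0 < m) (hk : k ≤ K) :
    levelMean n m k ≤ K + 1 := by
  refine (levelMean_le hm).trans ?_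
  have h1 : (1 : ℝ) ≤ m := by exact_mod_cast hm
  have h2 : (k : ℝ) ≤ K := by exact_mod_cast hk
  rw [div_le_iff₀ (by linarith)]
  nlinarith [(Nat.cast_nonneg K : (0 : ℝ) ≤ K)]

/-- A crude bound, since only linearity in `P.card` matters. The four factors `K + 1` bound the mean
size of the first level, the possible depths `i`, the roots on the path, and the mean size of a
level in the frozen forest. -/
theorem sum_card_level_mul_self_le (P : Finset V) {k j K : ℕ} (hk : k ≤ K) (hj : j ≤ K) :
    ∑ h ∈ rootedForests P, ∑ q ∈ P, ((level P h q k).card : ℝ) * (level P h q j).card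
      ≤ (rootedForests P).card * ((P.card : ℝ) * (K + 1) ^ 4) := by
  rw [Finset.sum_comm]
  set m := P.card with hm
  have hkR : (k : ℝ) ≤ K := by exact_mod_cast hk
  have hjR : (j : ℝ) ≤ K := by exact_mod_cast hj
  have key : ∀ q ∈ P, ∑ h ∈ rootedForests P,
      ((level P h q k).card : ℝ) * (level P h q j).card
      ≤ (rootedForests P).card * ((K : ℝ) + 1) ^ 4 := by
    intro q hq
    have hm0 : 0 < m := Finset.card_pos.2 ⟨q, hq⟩
    have h1 := sum_card_level_mul_le hq k
      (φ := fun h => ((level P h q j).card : ℝ))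
      (Ξ := fun Q g => ∑ i ∈ Finset.range (j + 1), ∑ s ∈ Q \ P.erase q, ((level Q g s i).card : ℝ))
      (B := (j + 1) * ((k + 1) * (K + 1)))
      (fun h hh v hv => by
        have := card_level_le_freeze (h := h) (P := P) (Q := addOrbit P h v) (q := q)
          (fun x hx => mem_addOrbit.2 (Or.inl hx)) hq j
        exact_mod_cast this)
      (fun Q hQ hc => by
        rw [Finset.sum_comm]
        have h2 : ∀ i ∈ Finset.range (j + 1), ∑ h ∈ rootedForests Q, ∑ s ∈ Q \ P.erase q,
            ((level Q h s i).card : ℝ) ≤ (rootedForests Q).card * ((k + 1) * (K + 1)) := by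
          intro i hi
          rw [Finset.sum_comm, Finset.sum_congr rfl fun s hs =>
            sum_card_level (Finset.mem_sdiff.1 hs).1 i, Finset.sum_const,
            Finset.card_sdiff_of_subset ((Finset.erase_subset _ _).trans hQ),
            Finset.card_erase_of_mem hq, hc, ← hm, nsmul_eq_mul]
          have h3 : m + k - (m - 1) = k + 1 := by omega
          rw [h3]
          push_cast
          have h4 := levelMean_le_of_le (n := Fintype.card V) (m := m + k) (k := i) (K := K)
            (by omega) (by have := Finset.mem_range.1 hi; omega)
          calc ((k : ℝ) + 1) * ((rootedForests Q).card * levelMean (Fintype.card V) (m + k) i)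
              ≤ ((k : ℝ) + 1) * ((rootedForests Q).card * (K + 1)) := by gcongr
            _ = _ := by ring
        refine (Finset.sum_le_sum h2).trans ?_
        rw [Finset.sum_const, Finset.card_range, nsmul_eq_mul]
        apply le_of_eq; push_cast; ring)
    refine h1.trans ?_
    refine mul_le_mul_of_nonneg_left ?_ (Nat.cast_nonneg _)
    have h2 := levelMean_le_of_le (n := Fintype.card V) hm0 hk
    calc levelMean (Fintype.card V) m k * ((j + 1) * ((k + 1) * (K + 1)))
        ≤ ((K : ℝ) + 1) * ((K + 1) * ((K + 1) * (K + 1))) := by gcongr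
      _ = _ := by ring
  refine (Finset.sum_le_sum key).trans ?_
  rw [Finset.sum_const, nsmul_eq_mul]
  apply le_of_eq; ring

/-- Drop the factor `(m + k) / m ≥ 1`, bound the falling factorial below by `(n - m - k) ^ k` and
use Bernoulli. If `m + k > n` the left side is nonpositive. -/
theorem le_levelMean {n m k : ℕ} (hm : 0 < m) (hn : 0 < n) :
    1 - k * ((m + k : ℝ) / n) ≤ levelMean n m k := by
  have hnR : (0 : ℝ) < n := by exact_mod_cast hn
  have hmR : (0 : ℝ) < m := by exact_mod_cast hm
  rcases Nat.eq_zero_or_pos k with rfl | hk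
  · rw [levelMean_zero hm]; simp
  have hkR : (1 : ℝ) ≤ k := by exact_mod_cast hk
  rcases le_or_gt (m + k) n with hmk | hmk
  · have hmkR : (m + k : ℝ) ≤ n := by exact_mod_cast hmk
    -- The range in which Bernoulli's inequality is available.
    have h1 : (-2 : ℝ) ≤ -((m + k : ℝ) / n) := by
      have : (m + k : ℝ) / n ≤ 1 := (div_le_one hnR).2 hmkR
      linarith
    have h2 := one_add_mul_le_pow h1 k
    have h3 : ((n : ℝ) - (m + k)) ^ k ≤ ((n - m).descFactorial k : ℝ) := by
      have := Nat.pow_sub_le_descFactorial (n - m) k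
      have h4 : ((n - m + 1 - k : ℕ) : ℝ) ^ k ≤ ((n - m).descFactorial k : ℝ) := by
        exact_mod_cast this
      refine le_trans ?_ h4
      refine pow_le_pow_left₀ (by linarith) ?_ k
      have h5 : (n - (m + k) : ℕ) ≤ n - m + 1 - k := by omega
      have h6 : ((n - (m + k) : ℕ) : ℝ) = n - (m + k) := by
        rw [Nat.cast_sub hmk]; push_cast; ring
      rw [← h6]; exact_mod_cast h5
    have h4 : (1 + -((m + k : ℝ) / n)) ^ k = ((n : ℝ) - (m + k)) ^ k / (n : ℝ) ^ k := by
      rw [← div_pow]; congr 1; field_simp; ring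
    calc 1 - k * ((m + k : ℝ) / n) = 1 + k * -((m + k : ℝ) / n) := by ring
      _ ≤ ((n : ℝ) - (m + k)) ^ k / (n : ℝ) ^ k := by rw [← h4]; exact h2
      _ ≤ ((n - m).descFactorial k : ℝ) / (n : ℝ) ^ k := by gcongr
      _ ≤ levelMean n m k := by
        unfold levelMean
        rw [div_le_div_iff₀ (by positivity) (by positivity)]
        have h7 : (0 : ℝ) ≤ ((n - m).descFactorial k : ℝ) * (n : ℝ) ^ k := by positivity
        nlinarith [mul_nonneg h7 (by linarith : (0 : ℝ) ≤ k)]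
  · have hmkR : (n : ℝ) < m + k := by exact_mod_cast hmk
    have : 1 ≤ (m + k : ℝ) / n := (one_le_div hnR).2 hmkR.le
    have : 1 - k * ((m + k : ℝ) / n) ≤ 0 := by nlinarith
    exact this.trans (levelMean_nonneg _ _ _)

/-- The partial sums of the harmonic series. -/
noncomputable def harmonicSum (K : ℕ) : ℝ := ∑ k ∈ Finset.Icc 1 K, (1 / k : ℝ)

/-- A bound for the mean square deviation from `P.card * harmonicSum K` of the sum of the minimal
clocks on the paths to the roots from the vertices up to depth `K`. -/
noncomputable def deviation (K : ℕ) (P : Finset V) (h : V → V) : ℝ :=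
  ∑ k ∈ Finset.Icc 1 K, ∑ j ∈ Finset.Icc 1 K, (1 / k * (1 / j) : ℝ) *
      ∑ q ∈ P, ∑ q' ∈ P.erase q, ((level P h q k).card : ℝ) * (level P h q' j).card
    + 2 * ∑ k ∈ Finset.Icc 1 K, ∑ j ∈ Finset.Icc 1 K,
      ∑ q ∈ P, ((level P h q k).card : ℝ) * (level P h q j).card
    - 2 * (P.card * harmonicSum K) *
      ∑ k ∈ Finset.Icc 1 K, (1 / k : ℝ) * ∑ q ∈ P, ((level P h q k).card : ℝ)
    + (P.card * harmonicSum K) ^ 2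

theorem harmonicSum_nonneg (K : ℕ) : 0 ≤ harmonicSum K :=
  Finset.sum_nonneg fun _ _ => by positivity

/-- The terms `m ^ 2 * H ^ 2` from the product over distinct trees, from the cross term and from the
square of the centre cancel as `1 - 2 + 1`. What is left is of order `m + m ^ 3 / n` for fixed `K`,
up to lower order terms, hence small compared with `m ^ 2` in the relevant range. -/
theorem sum_deviation_le (K : ℕ) {P : Finset V} (hP : P.Nonempty) :
    ∑ h ∈ rootedForests P, deviation K P h ≤ (rootedForests P).card *
      (2 * K * P.card * harmonicSum K ^ 2 + 2 * K ^ 2 * (K + 1) ^ 4 * P.card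
        + 2 * P.card ^ 2 * harmonicSum K ^ 2 * (K * (P.card + K) / Fintype.card V)) := by
  set m := P.card with hm
  set N := ((rootedForests P).card : ℝ) with hN
  set H := harmonicSum K with hH
  have hm0 : 0 < m := hP.card_pos
  have hn : 0 < Fintype.card V := Fintype.card_pos_iff.2 ⟨hP.choose⟩
  have hnR : (0 : ℝ) < Fintype.card V := by exact_mod_cast hn
  have hN0 : 0 ≤ N := Nat.cast_nonneg _
  have hH0 : 0 ≤ H := harmonicSum_nonneg K
  have hle : ∀ k ∈ Finset.Icc 1 K, (k : ℝ) ≤ K := fun k hk => by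
    exact_mod_cast (Finset.mem_Icc.1 hk).2
  have e1 : ∑ h ∈ rootedForests P, ∑ k ∈ Finset.Icc 1 K, ∑ j ∈ Finset.Icc 1 K,
      (1 / k * (1 / j) : ℝ) *
      ∑ q ∈ P, ∑ q' ∈ P.erase q, ((level P h q k).card : ℝ) * (level P h q' j).card
      ≤ N * (m * (m + 2 * K) * H ^ 2) := by
    rw [Finset.sum_comm]
    have : N * (m * (m + 2 * K) * H ^ 2) = ∑ k ∈ Finset.Icc 1 K, ∑ j ∈ Finset.Icc 1 K,
        (1 / k * (1 / j) : ℝ) * (N * (m * (m + 2 * K))) := by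
      simp_rw [← Finset.sum_mul]
      rw [← Finset.sum_mul_sum, hH, harmonicSum]; ring
    rw [this]
    refine Finset.sum_le_sum fun k hk => ?_
    rw [Finset.sum_comm]
    refine Finset.sum_le_sum fun j hj => ?_
    rw [← Finset.mul_sum]
    refine mul_le_mul_of_nonneg_left ((sum_card_level_mul_ne_le P k j).trans ?_) (by positivity)
    have := hle k hk
    have := hle j hj
    gcongr N * (m * ?_)
    linarith
  have e2 : ∑ h ∈ rootedForests P, ∑ k ∈ Finset.Icc 1 K, ∑ j ∈ Finset.Icc 1 K,
      ∑ q ∈ P, ((level P h q k).card : ℝ) * (level P h q j).card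
      ≤ N * (K ^ 2 * (K + 1) ^ 4 * m) := by
    rw [Finset.sum_comm]
    have : N * (K ^ 2 * (K + 1) ^ 4 * m) = ∑ k ∈ Finset.Icc 1 K, ∑ j ∈ Finset.Icc 1 K,
        N * (m * (K + 1) ^ 4 : ℝ) := by
      simp only [Finset.sum_const, Nat.card_Icc, nsmul_eq_mul, Nat.add_sub_cancel]; ring
    rw [this]
    refine Finset.sum_le_sum fun k hk => ?_
    rw [Finset.sum_comm]
    exact Finset.sum_le_sum fun j hj => sum_card_level_mul_self_le P (Finset.mem_Icc.1 hk).2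
      (Finset.mem_Icc.1 hj).2
  have e3 : N * (m * H * (1 - K * (m + K) / Fintype.card V)) ≤ ∑ h ∈ rootedForests P,
      ∑ k ∈ Finset.Icc 1 K, (1 / k : ℝ) * ∑ q ∈ P, ((level P h q k).card : ℝ) := by
    rw [Finset.sum_comm]
    have : N * (m * H * (1 - K * (m + K) / Fintype.card V)) = ∑ k ∈ Finset.Icc 1 K,
        (1 / k : ℝ) * (m * (N * (1 - K * (m + K) / Fintype.card V))) := by
      rw [← Finset.sum_mul, hH, harmonicSum]; ring
    rw [this]
    refine Finset.sum_le_sum fun k hk => ?_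
    rw [← Finset.mul_sum, Finset.sum_comm, Finset.sum_congr rfl fun q hq => sum_card_level hq k,
      Finset.sum_const, nsmul_eq_mul]
    have h1 := hle k hk
    have h2 := le_levelMean (m := m) (k := k) hm0 hn
    have h3 : (k : ℝ) * ((m + k) / Fintype.card V) ≤ K * (m + K) / Fintype.card V := by
      rw [mul_div_assoc]; gcongr
    refine mul_le_mul_of_nonneg_left ?_ (by positivity)
    refine mul_le_mul_of_nonneg_left ?_ (by positivity)
    refine mul_le_mul_of_nonneg_left ?_ hN0
    linarith
  unfold deviation
  rw [Finset.sum_add_distrib, Finset.sum_sub_distrib, Finset.sum_add_distrib, ← Finset.mul_sum,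
    ← Finset.mul_sum, Finset.sum_const, nsmul_eq_mul, ← hm, ← hH, ← hN]
  have e4 := mul_le_mul_of_nonneg_left e3 (by positivity : 0 ≤ 2 * ((m : ℝ) * H))
  calc _ ≤ N * (m * (m + 2 * K) * H ^ 2) + 2 * (N * (K ^ 2 * (K + 1) ^ 4 * m))
      - 2 * (m * H) * (N * (m * H * (1 - K * (m + K) / Fintype.card V))) + N * (m * H) ^ 2 := by
        gcongr
    _ = _ := by ring

end SecondMoment

/-! ### Trees as parent maps -/

section Trees

variable {V : Type*}

/-- The graph in which every vertex is joined to its parent. -/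
def treeOf (p : V → V) : SimpleGraph V where
  Adj a b := a ≠ b ∧ (p a = b ∨ p b = a)
  symm := ⟨fun _ _ h => ⟨h.1.symm, h.2.symm⟩⟩
  loopless := ⟨fun _ h => h.1 rfl⟩

theorem treeOf_adj {p : V → V} {a b : V} :
    (treeOf p).Adj a b ↔ a ≠ b ∧ (p a = b ∨ p b = a) := Iff.rfl

theorem reachable_iterate (p : V → V) (v : V) (k : ℕ) : (treeOf p).Reachable v (p^[k] v) := by
  induction k with
  | zero => exact SimpleGraph.Reachable.refl _
  | succ k ih =>
    rw [Function.iterate_succ_apply']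
    refine ih.trans ?_
    by_cases h : p^[k] v = p (p^[k] v)
    · rw [← h]
    · exact SimpleGraph.Adj.reachable ⟨h, Or.inl rfl⟩

variable [Fintype V] [DecidableEq V]

theorem parent_ne {p : V → V} {P : Finset V} (hp : p ∈ rootedForests P) {v : V} (hv : v ∉ P) :
    p v ≠ v := iterate_succ_ne_self hp hv 0

theorem apply_root {p : V → V} {ρ : V} (hp : p ∈ rootedForests {ρ}) : p ρ = ρ :=
  (mem_rootedForests.1 hp).1 ρ (Finset.mem_singleton_self ρ)

theorem exists_iterate_eq_root {p : V → V} {ρ : V} (hp : p ∈ rootedForests {ρ}) (v : V) :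
    ∃ k, p^[k] v = ρ :=
  ((mem_rootedForests.1 hp).2 v).imp fun _ hk => Finset.mem_singleton.1 hk

theorem treeOf_adj_parent {p : V → V} {ρ : V} (hp : p ∈ rootedForests {ρ}) {v : V} (hv : v ≠ ρ) :
    (treeOf p).Adj v (p v) :=
  ⟨(parent_ne hp (by simpa using hv)).symm, Or.inl rfl⟩

theorem exists_eq_of_mem_edgeSet {p : V → V} {ρ : V} (hp : p ∈ rootedForests {ρ}) {e : Sym2 V}
    (he : e ∈ (treeOf p).edgeSet) : ∃ v, v ≠ ρ ∧ e = s(v, p v) := by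
  induction e with
  | _ a b =>
    obtain ⟨hab, h | h⟩ := treeOf_adj.1 ((SimpleGraph.mem_edgeSet _).1 he)
    · refine ⟨a, ?_, by rw [h]⟩
      rintro rfl; exact hab (by rw [← h, apply_root hp])
    · refine ⟨b, ?_, by rw [h, Sym2.eq_swap]⟩
      rintro rfl; exact hab (by rw [← h, apply_root hp])

/-- If the two edges agreed with their ends exchanged, `v` would be periodic with period two. -/
theorem parentEdge_injective {p : V → V} {ρ : V} (hp : p ∈ rootedForests {ρ}) {v w : V}
    (hv : v ≠ ρ) (h : s(v, p v) = s(w, p w)) : v = w := by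
  rcases Sym2.eq_iff.1 h with ⟨h1, -⟩ | ⟨h1, h2⟩
  · exact h1
  · exact absurd (show p^[1 + 1] v = v by simp [h2, ← h1])
      (iterate_succ_ne_self hp (by simpa using hv) 1)

/-- Every edge is the parent edge of a vertex other than `ρ`, so this connected graph has at most `n
- 1` edges. -/
theorem treeOf_isTree {p : V → V} {ρ : V} (hp : p ∈ rootedForests {ρ}) : (treeOf p).IsTree := by
  have hroot : ∀ v, (treeOf p).Reachable v ρ := by
    intro v
    obtain ⟨k, hk⟩ := exists_iterate_eq_root hp v
    rw [← hk]; exact reachable_iterate p v k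
  have hconn : (treeOf p).Connected :=
    { preconnected := fun a b => (hroot a).trans (hroot b).symm
      nonempty := ⟨ρ⟩ }
  refine SimpleGraph.isTree_iff_connected_and_card.2 ⟨hconn, le_antisymm ?_
    hconn.card_vert_le_card_edgeSet_add_one⟩
  have h1 : (treeOf p).edgeSet
      ⊆ ((Finset.univ.erase ρ).image fun v => s(v, p v) : Finset (Sym2 V)) := by
    intro e he
    obtain ⟨v, hv, rfl⟩ := exists_eq_of_mem_edgeSet hp he
    simpa using ⟨v, hv, Or.inl ⟨rfl, rfl⟩⟩
  have h2 := Set.ncard_le_ncard h1 (Finset.finite_toSet _)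
  rw [Set.ncard_coe_finset] at h2
  have h3 := h2.trans Finset.card_image_le
  rw [Finset.card_erase_of_mem (Finset.mem_univ _), Finset.card_univ] at h3
  have h4 : 0 < Fintype.card V := Fintype.card_pos_iff.2 ⟨ρ⟩
  rw [Nat.card_eq_fintype_card (α := V)]
  have h5 : Nat.card (treeOf p).edgeSet = (treeOf p).edgeSet.ncard := rfl
  omega

/-- Where two parent maps of the same graph disagree, one traverses the edge in the opposite
direction, and this propagates along the whole orbit: the orbit under `p'` of a vertex of
disagreement can never reach `ρ`. -/
theorem treeOf_injOn (ρ : V) : Set.InjOn treeOf (rootedForests {ρ} : Set (V → V)) := by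
  intro p hp p' hp' heq
  rw [Finset.mem_coe] at hp hp'
  by_contra hne
  obtain ⟨v, hv⟩ := Function.ne_iff.1 hne
  have hvρ : v ≠ ρ := by
    rintro rfl; exact hv (by rw [apply_root hp, apply_root hp'])
  have hadj : ∀ w, w ≠ ρ → p w = p' w ∨ p (p' w) = w := fun w hw => by
    have := treeOf_adj_parent hp' hw
    rw [← heq] at this
    exact this.2
  have key : ∀ i, p'^[i] v ≠ ρ ∧ p (p'^[i + 1] v) = p'^[i] v := by
    intro i
    induction i with
    | zero => exact ⟨hvρ, (hadj v hvρ).resolve_left hv⟩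
    | succ i ih =>
      obtain ⟨h1, h2⟩ := ih
      have h3 : p'^[i + 1] v ≠ ρ := by
        intro h; rw [h, apply_root hp] at h2; exact h1 h2.symm
      refine ⟨h3, ?_⟩
      rw [Function.iterate_succ_apply' p' (i + 1)]
      refine (hadj _ h3).resolve_left fun h4 => ?_
      rw [h2] at h4
      refine iterate_succ_ne_self hp' (b := p'^[i] v) (by simpa using h1) 1 ?_
      rw [Function.iterate_succ_apply', Function.iterate_one, ← Function.iterate_succ_apply' p' i]
      exact h4.symm
  obtain ⟨k, hk⟩ := exists_iterate_eq_root hp' v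
  exact (key k).1 hk

/-- Take as parent the next vertex on a geodesic to `ρ`. The resulting graph is connected and
contained in `T`, and a tree is a minimal connected graph. -/
theorem exists_treeOf_eq {T : SimpleGraph V} (hT : T.IsTree) (ρ : V) :
    ∃ p ∈ rootedForests {ρ}, treeOf p = T := by
  have hstep : ∀ v, ∃ w, (v = ρ → w = ρ) ∧ (v ≠ ρ → T.Adj v w ∧ T.dist w ρ < T.dist v ρ) := by
    intro v
    by_cases hv : v = ρ
    · exact ⟨ρ, fun _ => rfl, fun h => absurd hv h⟩
    · obtain ⟨W, hW⟩ := (hT.1.preconnected v ρ).exists_walk_length_eq_dist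
      cases W with
      | nil => exact absurd rfl hv
      | cons h W' =>
        rename_i w
        refine ⟨w, fun h => absurd h hv, fun _ => ⟨h, ?_⟩⟩
        rw [SimpleGraph.Walk.length_cons] at hW
        have := SimpleGraph.dist_le W'
        omega
  choose p hp1 hp2 using hstep
  have hp : p ∈ rootedForests {ρ} := by
    refine mem_rootedForests.2 ⟨fun a ha => ?_, ?_⟩
    · rw [Finset.mem_singleton] at ha; subst ha; exact hp1 a rfl
    · have : ∀ d v, T.dist v ρ ≤ d → ∃ k, p^[k] v ∈ ({ρ} : Finset V) := by
        intro d
        induction d with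
        | zero =>
          intro v hv
          refine ⟨0, ?_⟩
          by_contra hne
          have := (hp2 v (by simpa using hne)).2
          omega
        | succ d ih =>
          intro v hv
          by_cases hvρ : v = ρ
          · exact ⟨0, by simp [hvρ]⟩
          · obtain ⟨k, hk⟩ := ih (p v) (by have := (hp2 v hvρ).2; omega)
            exact ⟨k + 1, by rwa [Function.iterate_succ_apply]⟩
      exact fun v => this _ v le_rfl
  refine ⟨p, hp, ?_⟩
  have hle : treeOf p ≤ T := by
    intro a b hab
    obtain ⟨hne, h | h⟩ := hab
    · have ha : a ≠ ρ := by rintro rfl; exact hne (by rw [← h, apply_root hp])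
      rw [← h]; exact (hp2 a ha).1
    · have hb : b ≠ ρ := by rintro rfl; exact hne (by rw [← h, apply_root hp])
      rw [← h]; exact (hp2 b hb).1.symm
  exact le_antisymm hle
    ((SimpleGraph.isTree_iff_minimal_connected.1 hT).2 (treeOf_isTree hp).1 hle)

theorem image_treeOf (ρ : V) :
    treeOf '' (rootedForests {ρ} : Set (V → V)) = {T : SimpleGraph V | T.IsTree} := by
  ext T
  constructor
  · rintro ⟨p, hp, rfl⟩; exact treeOf_isTree hp
  · intro hT
    obtain ⟨p, hp, rfl⟩ := exists_treeOf_eq hT ρ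
    exact ⟨p, hp, rfl⟩

end Trees

/-! ### The fire dynamics as a fold over the rings -/

section Dynamics

theorem EdgeState.eq_fireproof {s : EdgeState} (h1 : s ≠ EdgeState.inflammable)
    (h2 : s ≠ EdgeState.burnt) : s = EdgeState.fireproof := by
  cases s <;> simp_all

variable {V : Type*} {G : SimpleGraph V}

theorem Spreads.eq_or_inflammable {σ : Config G} {a b : G.edgeSet} (h : Spreads G σ a b) :
    b = a ∨ σ b = EdgeState.inflammable := by
  rcases Relation.ReflTransGen.cases_tail h with h | ⟨c, -, hc⟩
  · exact Or.inl h
  · exact Or.inr hc.2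

theorem applyRing_inl_of_ne {σ : Config G} {e f : G.edgeSet} (hef : e ≠ f) :
    applyRing G σ (Sum.inl f) e = σ e := by
  classical
  simp only [applyRing]
  split_ifs
  · exact Function.update_of_ne hef _ _
  · rfl

theorem applyRing_inl_self_ne (σ : Config G) (e : G.edgeSet) :
    applyRing G σ (Sum.inl e) e ≠ EdgeState.inflammable := by
  simp only [applyRing]
  split_ifs with h
  · simp
  · exact h

theorem applyRing_inl_ne_burnt {σ : Config G} {e : G.edgeSet} (he : σ e ≠ EdgeState.burnt)
    (f : G.edgeSet) : applyRing G σ (Sum.inl f) e ≠ EdgeState.burnt := by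
  by_cases hef : e = f
  · subst hef
    simp only [applyRing]
    split_ifs
    · simp
    · exact he
  · rwa [applyRing_inl_of_ne hef]

theorem applyRing_inr_of_spreads {σ : Config G} {e f : G.edgeSet}
    (hf : σ f = EdgeState.inflammable) (hs : Spreads G σ f e) :
    applyRing G σ (Sum.inr f) e = EdgeState.burnt := by
  simp only [applyRing, if_pos hf]
  exact if_pos hs

theorem applyRing_inr_of_not {σ : Config G} {e f : G.edgeSet}
    (h : σ f = EdgeState.inflammable → ¬ Spreads G σ f e) :
    applyRing G σ (Sum.inr f) e = σ e := by
  by_cases hf : σ f = EdgeState.inflammable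
  · simp only [applyRing, if_pos hf]
    exact if_neg (h hf)
  · simp only [applyRing, if_neg hf]

/-- A ring only changes inflammable edges. -/
theorem applyRing_eq_of_ne {σ : Config G} {e : G.edgeSet} (he : σ e ≠ EdgeState.inflammable)
    (a : G.edgeSet ⊕ G.edgeSet) : applyRing G σ a e = σ e := by
  rcases a with f | f
  · by_cases hef : e = f
    · subst hef
      simp only [applyRing, if_neg he]
    · exact applyRing_inl_of_ne hef
  · refine applyRing_inr_of_not fun hf hs => ?_
    rcases hs.eq_or_inflammable with rfl | h
    · exact he hf
    · exact he h

theorem foldl_applyRing_eq_of_ne {e : G.edgeSet} (l : List (G.edgeSet ⊕ G.edgeSet))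
    {σ : Config G} (he : σ e ≠ EdgeState.inflammable) : l.foldl (applyRing G) σ e = σ e := by
  induction l generalizing σ with
  | nil => rfl
  | cons a l ih =>
    rw [List.foldl_cons, ih (by rwa [applyRing_eq_of_ne he]), applyRing_eq_of_ne he]

theorem foldl_applyRing_inl_ne {e : G.edgeSet} {l : List (G.edgeSet ⊕ G.edgeSet)}
    (he : Sum.inl e ∈ l) (σ : Config G) :
    l.foldl (applyRing G) σ e ≠ EdgeState.inflammable := by
  obtain ⟨l1, l2, rfl⟩ := List.append_of_mem he
  rw [List.foldl_append, List.foldl_cons, foldl_applyRing_eq_of_ne _ (applyRing_inl_self_ne _ e)]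
  exact applyRing_inl_self_ne _ e

variable [Fintype V] {F I : G.edgeSet → ℝ}

theorem mem_rings (a : G.edgeSet ⊕ G.edgeSet) : a ∈ rings G F I := by
  classical
  unfold rings
  rw [List.mem_mergeSort]
  simp

theorem rings_pairwise :
    (rings G F I).Pairwise fun a b => Sum.elim F I a ≤ Sum.elim F I b := by
  classical
  have := List.pairwise_mergeSort (le := fun a b : G.edgeSet ⊕ G.edgeSet =>
    decide (Sum.elim F I a ≤ Sum.elim F I b))
    (by intro a b c h1 h2; simp only [decide_eq_true_eq] at *; exact h1.trans h2)
    (by intro a b; simpa using le_total _ _)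
    (Finset.univ : Finset (G.edgeSet ⊕ G.edgeSet)).toList
  refine List.Pairwise.imp ?_ (this)
  intro a b h
  simpa using h

theorem mem_left_of_lt {l1 l2 : List (G.edgeSet ⊕ G.edgeSet)} {a b : G.edgeSet ⊕ G.edgeSet}
    (hl : rings G F I = l1 ++ a :: l2) (hab : Sum.elim F I b < Sum.elim F I a) : b ∈ l1 := by
  have h1 := rings_pairwise (G := G) (F := F) (I := I)
  have h2 := mem_rings (G := G) (F := F) (I := I) b
  rw [hl] at h1 h2
  rcases List.mem_append.1 h2 with h2 | h2
  · exact h2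
  · have h3 := List.pairwise_cons.1 (List.pairwise_append.1 h1).2.1
    rcases List.mem_cons.1 h2 with rfl | h2
    · exact absurd hab (lt_irrefl _)
    · exact absurd hab (h3.1 b h2).not_gt

theorem le_of_mem_left {l1 l2 : List (G.edgeSet ⊕ G.edgeSet)} {a b : G.edgeSet ⊕ G.edgeSet}
    (hl : rings G F I = l1 ++ a :: l2) (hb : b ∈ l1) : Sum.elim F I b ≤ Sum.elim F I a := by
  have h1 := rings_pairwise (G := G) (F := F) (I := I)
  rw [hl] at h1
  exact (List.pairwise_append.1 h1).2.2 b hb a List.mem_cons_self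

/-- There are finitely many rings, so the configuration is eventually constant in time; from here on
real time enters only through the order of the rings. -/
theorem fireproofEdge_iff {e : G.edgeSet} :
    FireproofEdge G F I e ↔
      (rings G F I).foldl (applyRing G) (fun _ => EdgeState.inflammable) e
        = EdgeState.fireproof := by
  classical
  have h1 : ∀ᶠ t : ℝ in atTop, configAt G F I t
      = (rings G F I).foldl (applyRing G) fun _ => EdgeState.inflammable := by
    have h2 : ∀ᶠ t : ℝ in atTop, ∀ a : G.edgeSet ⊕ G.edgeSet, Sum.elim F I a ≤ t :=
      Filter.eventually_all.2 fun a => Filter.eventually_ge_atTop _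
    filter_upwards [h2] with t ht
    unfold configAt
    rw [List.filter_eq_self.2 fun a _ => by simpa using ht a]
  unfold FireproofEdge
  constructor
  · intro h
    obtain ⟨t, ht1, ht2⟩ := (h1.and h).exists
    rw [← ht1]; exact ht2
  · intro h
    filter_upwards [h1] with t ht
    rw [ht]; exact h

end Dynamics

/-! ### Connection in terms of clock comparisons -/

section TreeDynamics

theorem iterate_mem_of_closed {V : Type*} {P : Finset V} {p : V → V} (hcl : ∀ x ∈ P, p x ∈ P) {x : V}
    (hx : x ∈ P) (i : ℕ) : p^[i] x ∈ P := by
  induction i with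
  | zero => exact hx
  | succ i ih => rw [Function.iterate_succ_apply']; exact hcl _ ih

variable {V : Type*} [Fintype V] [DecidableEq V]

open Classical in
/-- The vertices outside of `P` of the orbit of `v`. -/
noncomputable def pathAbove (P : Finset V) (h : V → V) (v : V) : Finset V :=
  Finset.univ.filter fun w => w ∉ P ∧ ∃ i, h^[i] v = w

theorem mem_pathAbove {P : Finset V} {h : V → V} {v w : V} :
    w ∈ pathAbove P h v ↔ w ∉ P ∧ ∃ i, h^[i] v = w := by
  simp [pathAbove]

/-- The fireproof forest of the tree of a parent map. -/
abbrev parentForest (p : V → V) (F I : Sym2 V → ℝ) : (treeOf p).Subgraph :=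
  fireproofForest (treeOf p) (fun e => F e) (fun e => I e)

variable {p : V → V} {ρ : V} {P : Finset V} {F I : Sym2 V → ℝ}

/-- When the edge of `v` ignites, the edge above `w` is no longer inflammable and acts as a barrier:
the fire is confined to strict descendants of `w`, which are not in `P` because `P` is closed under
`p`. Whether the barrier is fireproof or burnt is irrelevant. -/
theorem fireproofVertex_of_forall_exists_lt (hp : p ∈ rootedForests {ρ}) (hρ : ρ ∈ P)
    (hcl : ∀ x ∈ P, p x ∈ P)
    (h1 : ∀ v ∉ P, ∃ w ∈ pathAbove P p v, F s(w, p w) < I s(v, p v))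
    (h2 : ∀ v ∈ P, v ≠ ρ → F s(v, p v) < I s(v, p v)) {x : V} (hx : x ∈ P) :
    FireproofVertex (treeOf p) (fun e => F e) (fun e => I e) x := by
  set F' : (treeOf p).edgeSet → ℝ := fun e => F e with hF'
  set I' : (treeOf p).edgeSet → ℝ := fun e => I e with hI'
  have hne : ∀ w ∉ P, w ≠ ρ := by rintro w hw rfl; exact hw hρ
  have key : ∀ l1 l2, rings (treeOf p) F' I' = l1 ++ l2 → ∀ e : (treeOf p).edgeSet,
      (∃ y ∈ P, y ∈ (e : Sym2 V)) →
      l1.foldl (applyRing (treeOf p)) (fun _ => EdgeState.inflammable) e ≠ EdgeState.burnt := by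
    intro l1
    induction l1 using List.reverseRecOn with
    | nil => intro l2 _ e _; simp
    | append_singleton l a ih =>
      intro l2 hl e he
      have hl' : rings (treeOf p) F' I' = l ++ a :: l2 := by rw [hl]; simp
      have ihe := ih (a :: l2) hl' e he
      rw [List.foldl_append, List.foldl_cons, List.foldl_nil]
      set σ := l.foldl (applyRing (treeOf p)) (fun _ => EdgeState.inflammable) with hσ
      rcases a with f | f
      · exact applyRing_inl_ne_burnt ihe f
      · by_cases hfs : σ f = EdgeState.inflammable ∧ Spreads (treeOf p) σ f e
        · exfalso
          obtain ⟨hf, hs⟩ := hfs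
          obtain ⟨v, hv, hfv⟩ := exists_eq_of_mem_edgeSet hp f.2
          by_cases hvP : v ∈ P
          · have h3 : Sum.inl f ∈ l := mem_left_of_lt hl' (by
              simp only [Sum.elim_inl, Sum.elim_inr, hF', hI', hfv]; exact h2 v hvP hv)
            exact foldl_applyRing_inl_ne h3 _ hf
          · obtain ⟨w, hw, hwv⟩ := h1 v hvP
            obtain ⟨hwP, i0, hi0⟩ := mem_pathAbove.1 hw
            have hg : s(w, p w) ∈ (treeOf p).edgeSet := treeOf_adj_parent hp (hne w hwP)
            have h3 : Sum.inl ⟨s(w, p w), hg⟩ ∈ l := mem_left_of_lt hl' (by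
              simp only [Sum.elim_inl, Sum.elim_inr, hF', hI', hfv]; exact hwv)
            have h4 : σ ⟨s(w, p w), hg⟩ ≠ EdgeState.inflammable := foldl_applyRing_inl_ne h3 _
            have h5 : ∀ g : (treeOf p).edgeSet, σ g = EdgeState.inflammable → ∀ y,
                (g : Sym2 V) = s(y, p y) → y ≠ w := by
              rintro g hg' y hy rfl
              exact h4 (by rw [← hg']; congr 1; exact Subtype.ext hy.symm)
            -- Invariant of the spreading fire: every edge that it reaches lies strictly below `w`.
            -- Leaving the descendants of `w` would require the edge above `w` itself.
            have h6 : ∀ g, Spreads (treeOf p) σ f g →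
                ∃ y, (g : Sym2 V) = s(y, p y) ∧ y ≠ w ∧ ∃ i, p^[i] y = w := by
              intro g hsg
              induction hsg with
              | refl => exact ⟨v, hfv, h5 f hf v hfv, i0, hi0⟩
              | @tail b c _ hst ihs =>
                obtain ⟨y, hy1, hy2, i, hi⟩ := ihs
                obtain ⟨⟨z, hz1, hz2⟩, hc⟩ := hst
                obtain ⟨y', hy', hc'⟩ := exists_eq_of_mem_edgeSet hp c.2
                refine ⟨y', hc', h5 c hc y' hc', ?_⟩
                rw [hy1, Sym2.mem_iff] at hz1
                rw [hc', Sym2.mem_iff] at hz2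
                obtain ⟨j, rfl⟩ : ∃ j, i = j + 1 := by
                  rcases i with _ | j
                  · exact absurd hi hy2
                  · exact ⟨j, rfl⟩
                have hi' := hi
                rw [Function.iterate_succ_apply] at hi'
                rcases hz1 with rfl | rfl <;> rcases hz2 with hz | hz
                · exact ⟨j + 1, by rw [← hz]; exact hi⟩
                · exact ⟨j + 2, by rw [Function.iterate_succ_apply, ← hz]; exact hi⟩
                · exact ⟨j, by rw [← hz]; exact hi'⟩
                · exact ⟨j + 1, by rw [Function.iterate_succ_apply, ← hz]; exact hi'⟩
            obtain ⟨y, hy1, hy2, i, hi⟩ := h6 e hs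
            obtain ⟨t, htP, hte⟩ := he
            rw [hy1, Sym2.mem_iff] at hte
            rcases i with _ | j
            · exact hy2 hi
            · rcases hte with rfl | rfl
              · exact hwP (hi ▸ iterate_mem_of_closed hcl htP (j + 1))
              · exact hwP (hi ▸ iterate_mem_of_closed hcl htP j)
        · rwa [applyRing_inr_of_not fun h1 h2 => hfs ⟨h1, h2⟩]
  intro e he
  rw [fireproofEdge_iff]
  exact EdgeState.eq_fireproof (foldl_applyRing_inl_ne (mem_rings _) _)
    (key _ [] (by simp) e ⟨x, hx, he⟩)

theorem sameComponent_of_forall_exists_lt (hp : p ∈ rootedForests {ρ}) {u : V}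
    (h1 : ∀ v ∉ addOrbit {ρ} p u,
      ∃ w ∈ pathAbove (addOrbit {ρ} p u) p v, F s(w, p w) < I s(v, p v))
    (h2 : ∀ v ∈ addOrbit {ρ} p u, v ≠ ρ → F s(v, p v) < I s(v, p v)) :
    SameComponent (parentForest p F I) u ρ := by
  have hρ : ρ ∈ addOrbit {ρ} p u := mem_addOrbit.2 (Or.inl (Finset.mem_singleton_self ρ))
  have hcl : ∀ x ∈ addOrbit {ρ} p u, p x ∈ addOrbit {ρ} p u := by
    intro x hx
    rcases mem_addOrbit.1 hx with hx | ⟨i, rfl⟩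
    · rw [Finset.mem_singleton] at hx; subst hx; rw [apply_root hp]; exact hρ
    · exact mem_addOrbit.2 (Or.inr ⟨i + 1, Function.iterate_succ_apply' p i u⟩)
  have hfp : ∀ x ∈ addOrbit {ρ} p u,
      FireproofVertex (treeOf p) (fun e => F e) (fun e => I e) x := fun x hx =>
    fireproofVertex_of_forall_exists_lt hp hρ hcl h1 h2 hx
  have hu : ∀ i, p^[i] u ∈ (parentForest p F I).verts := fun i =>
    hfp _ (mem_addOrbit.2 (Or.inr ⟨i, rfl⟩))
  obtain ⟨k, hk⟩ := exists_iterate_eq_root hp u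
  have hreach : ∀ i, (parentForest p F I).coe.Reachable ⟨u, hu 0⟩ ⟨p^[i] u, hu i⟩ := by
    intro i
    induction i with
    | zero => exact SimpleGraph.Reachable.refl _
    | succ i ih =>
      refine ih.trans ?_
      by_cases h : p^[i] u = p^[i + 1] u
      · have : (⟨p^[i] u, hu i⟩ : (parentForest p F I).verts) = ⟨p^[i + 1] u, hu (i + 1)⟩ :=
          Subtype.ext h
        rw [this]
      · refine SimpleGraph.Adj.reachable ?_
        rw [SimpleGraph.Subgraph.coe_adj]
        have hadj : (treeOf p).Adj (p^[i] u) (p^[i + 1] u) :=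
          ⟨h, Or.inl (Function.iterate_succ_apply' p i u).symm⟩
        exact ⟨⟨hadj, hu i _ (Sym2.mem_mk_left _ _)⟩, hu i, hu (i + 1)⟩
  subst hk
  exact ⟨hu 0, hu k, hreach k⟩

/-- Until the edge of `v` ignites, no edge on the way from `v` to `P` has had its fireproofing ring.
A fire that touches this chain therefore burns through to its last edge `c m`, which is incident to
`P`. At the latest this happens at the ignition of `v`. -/
theorem exists_not_fireproofVertex (hp : p ∈ rootedForests {ρ}) (hρ : ρ ∈ P) {v : V} (hv : v ∉ P)
    (hlt : ∀ w ∈ pathAbove P p v, I s(v, p v) < F s(w, p w)) :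
    ∃ x ∈ P, ¬ FireproofVertex (treeOf p) (fun e => F e) (fun e => I e) x := by
  set F' : (treeOf p).edgeSet → ℝ := fun e => F e with hF'
  set I' : (treeOf p).edgeSet → ℝ := fun e => I e with hI'
  obtain ⟨k, hk, hk'⟩ := exists_first_iterate (h := p) (v := v) (p := fun w => w ∈ P) (by
    obtain ⟨k, hk⟩ := exists_iterate_eq_root hp v
    exact ⟨k, hk ▸ hρ⟩)
  obtain ⟨m, rfl⟩ : ∃ m, k = m + 1 := by
    rcases k with _ | m
    · exact absurd hk hv
    · exact ⟨m, rfl⟩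
  have hedge : ∀ i, i ≤ m → s(p^[i] v, p (p^[i] v)) ∈ (treeOf p).edgeSet := fun i hi =>
    treeOf_adj_parent hp (fun h => hk' i (by omega) (by have h' : p^[i] v = ρ := h; rw [h']; exact hρ))
  set c : ∀ i, i ≤ m → (treeOf p).edgeSet := fun i hi => ⟨s(p^[i] v, p (p^[i] v)), hedge i hi⟩
    with hc
  have hspread : ∀ σ : Config (treeOf p), (∀ i hi, σ (c i hi) = EdgeState.inflammable) →
      ∀ i hi, Spreads (treeOf p) σ (c i hi) (c m le_rfl) := by
    intro σ hσ i hi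
    have : ∀ j (hij : i ≤ j) (hj : j ≤ m), Spreads (treeOf p) σ (c i hi) (c j hj) := by
      intro j hij
      induction j, hij using Nat.le_induction with
      | base => intro _; exact Relation.ReflTransGen.refl
      | succ j hij ih =>
        intro hj
        refine (ih (by omega)).tail ⟨⟨p^[j + 1] v, ?_, ?_⟩, hσ (j + 1) hj⟩
        · simp only [hc]
          rw [Function.iterate_succ_apply']; exact Sym2.mem_mk_right _ _
        · exact Sym2.mem_mk_left _ _
    exact this m hi le_rfl
  have hfire : ∀ σ : Config (treeOf p), (∀ i hi, σ (c i hi) = EdgeState.inflammable) →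
      ∀ f, (∃ i hi, Spreads (treeOf p) σ f (c i hi)) → σ f = EdgeState.inflammable →
      applyRing (treeOf p) σ (Sum.inr f) (c m le_rfl) = EdgeState.burnt := by
    rintro σ hσ f ⟨i, hi, hs⟩ hf
    exact applyRing_inr_of_spreads hf (hs.trans (hspread σ hσ i hi))
  -- All or nothing: before any fireproofing ring on the chain, either the chain is intact or its
  -- last edge is already burnt.
  have key : ∀ l : List ((treeOf p).edgeSet ⊕ (treeOf p).edgeSet),
      (∀ i hi, Sum.inl (c i hi) ∉ l) →
      (∀ i hi, l.foldl (applyRing (treeOf p)) (fun _ => EdgeState.inflammable) (c i hi)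
        = EdgeState.inflammable) ∨
      l.foldl (applyRing (treeOf p)) (fun _ => EdgeState.inflammable) (c m le_rfl)
        = EdgeState.burnt := by
    intro l
    induction l using List.reverseRecOn with
    | nil => intro _; exact Or.inl fun _ _ => rfl
    | append_singleton l a ih =>
      intro hl
      rw [List.foldl_append, List.foldl_cons, List.foldl_nil]
      set σ := l.foldl (applyRing (treeOf p)) (fun _ => EdgeState.inflammable)
      rcases ih fun i hi h => hl i hi (List.mem_append_left _ h) with h | h
      · rcases a with f | f
        · left
          intro i hi
          rw [applyRing_inl_of_ne, h i hi]
          rintro rfl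
          exact hl i hi (by simp)
        · by_cases hs : σ f = EdgeState.inflammable ∧ ∃ i hi, Spreads (treeOf p) σ f (c i hi)
          · exact Or.inr (hfire σ h f hs.2 hs.1)
          · left
            intro i hi
            rw [applyRing_inr_of_not fun h1 h2 => hs ⟨h1, i, hi, h2⟩, h i hi]
      · right
        rw [applyRing_eq_of_ne (by rw [h]; simp), h]
  refine ⟨_, hk, fun hfp => ?_⟩
  have h1 := hfp (c m le_rfl) (by
    simp only [hc]
    rw [Function.iterate_succ_apply']; exact Sym2.mem_mk_right _ _)
  rw [fireproofEdge_iff] at h1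
  obtain ⟨l1, l2, hl⟩ := List.append_of_mem
    (mem_rings (F := F') (I := I') (Sum.inr (c 0 (Nat.zero_le m))))
  have h2 : ∀ i hi, Sum.inl (c i hi) ∉ l1 := by
    intro i hi hmem
    have h3 := le_of_mem_left hl hmem
    have h4 := hlt (p^[i] v) (mem_pathAbove.2 ⟨hk' i (by omega), i, rfl⟩)
    simp only [Sum.elim_inl, Sum.elim_inr, hF', hI', hc] at h3
    exact absurd h4 h3.not_gt
  have h5 : applyRing (treeOf p)
      (l1.foldl (applyRing (treeOf p)) (fun _ => EdgeState.inflammable))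
      (Sum.inr (c 0 (Nat.zero_le m))) (c m le_rfl) = EdgeState.burnt := by
    rcases key l1 h2 with h | h
    · exact hfire _ h _ ⟨0, Nat.zero_le m, Relation.ReflTransGen.refl⟩ (h 0 (Nat.zero_le m))
    · rw [applyRing_eq_of_ne (by rw [h]; simp), h]
  rw [hl, List.foldl_append, List.foldl_cons, foldl_applyRing_eq_of_ne _ (by rw [h5]; simp), h5]
    at h1
  exact absurd h1 (by simp)

/-- A walk from `u` to `ρ` cannot leave the subtree below `x` without passing through `x`. -/
theorem fireproofVertex_of_sameComponent (hp : p ∈ rootedForests {ρ}) {u : V}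
    (h : SameComponent (parentForest p F I) u ρ) {x : V} (hx : x ∈ addOrbit {ρ} p u) :
    x ∈ (parentForest p F I).verts := by
  obtain ⟨hu, hρ, hreach⟩ := h
  rcases mem_addOrbit.1 hx with hx | hx
  · rw [Finset.mem_singleton.1 hx]; exact hρ
  · by_contra hxv
    rw [SimpleGraph.reachable_iff_reflTransGen] at hreach
    have key : ∀ y : (parentForest p F I).verts,
        Relation.ReflTransGen (parentForest p F I).coe.Adj ⟨u, hu⟩ y → ∃ i, p^[i] (y : V) = x := by
      intro y hy
      induction hy with
      | refl => exact hx
      | @tail a b _ hadj ih =>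
        obtain ⟨i, hi⟩ := ih
        have h1 : (treeOf p).Adj (a : V) (b : V) := hadj.1.1
        rcases h1.2 with h2 | h2
        · rcases i with _ | i
          · have h3 : (a : V) = x := hi
            exact absurd (h3 ▸ a.2) hxv
          · exact ⟨i, by rw [← h2]; exact hi⟩
        · exact ⟨i + 1, by rw [Function.iterate_succ_apply, h2]; exact hi⟩
    obtain ⟨i, hi⟩ := key _ hreach
    rw [Function.iterate_fixed (apply_root hp)] at hi
    exact hxv (hi ▸ hρ)

theorem exists_le_of_sameComponent (hp : p ∈ rootedForests {ρ}) {u : V}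
    (h : SameComponent (parentForest p F I) u ρ) {v : V} (hv : v ∉ addOrbit {ρ} p u) :
    ∃ w ∈ pathAbove (addOrbit {ρ} p u) p v, F s(w, p w) ≤ I s(v, p v) := by
  by_contra! hlt
  obtain ⟨x, hx, hx'⟩ := exists_not_fireproofVertex hp
    (mem_addOrbit.2 (Or.inl (Finset.mem_singleton_self ρ))) hv hlt
  exact hx' (fireproofVertex_of_sameComponent hp h hx)

end TreeDynamics

/-! ### Minima of independent exponential clocks -/

section Clocks

theorem expMeasure_Iic {r : ℝ} (hr : 0 < r) {x : ℝ} (hx : 0 ≤ x) :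
    expMeasure r (Set.Iic x) = ENNReal.ofReal (1 - Real.exp (-(r * x))) := by
  have := isProbabilityMeasure_expMeasure hr
  rw [← ofReal_cdf, cdf_expMeasure_eq hr, if_pos hx]

theorem expMeasure_Iic_le {r : ℝ} (hr : 0 < r) {x : ℝ} (hx : 0 ≤ x) :
    expMeasure r (Set.Iic x) ≤ ENNReal.ofReal (r * x) := by
  rw [expMeasure_Iic hr hx]
  refine ENNReal.ofReal_le_ofReal ?_
  linarith [Real.add_one_le_exp (-(r * x))]

theorem expMeasure_Ioi {r : ℝ} (hr : 0 < r) {x : ℝ} (hx : 0 ≤ x) :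
    expMeasure r (Set.Ioi x) = ENNReal.ofReal (Real.exp (-(r * x))) := by
  have := isProbabilityMeasure_expMeasure hr
  rw [← Set.compl_Iic, prob_compl_eq_one_sub measurableSet_Iic, expMeasure_Iic hr hx,
    ← ENNReal.ofReal_one, ← ENNReal.ofReal_sub]
  · congr 1; ring
  · have : Real.exp (-(r * x)) ≤ 1 := Real.exp_le_one_iff.2 (by nlinarith)
    linarith

theorem expMeasure_singleton (r x : ℝ) : expMeasure r {x} = 0 :=
  withDensity_absolutelyContinuous _ _ (measure_singleton x)

theorem expMeasure_Ici {r : ℝ} (hr : 0 < r) {x : ℝ} (hx : 0 ≤ x) :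
    expMeasure r (Set.Ici x) = ENNReal.ofReal (Real.exp (-(r * x))) := by
  rw [← expMeasure_Ioi hr hx, ← Set.Ioi_union_left]
  refine le_antisymm ((measure_union_le _ _).trans ?_) (measure_mono Set.subset_union_left)
  rw [expMeasure_singleton, add_zero]

theorem expMeasure_ae_nonneg {r : ℝ} (hr : 0 < r) : ∀ᵐ x ∂expMeasure r, 0 ≤ x := by
  have h1 : expMeasure r (Set.Iic 0) = 0 := by simp [expMeasure_Iic hr le_rfl]
  refine measure_mono_null (fun x hx => ?_) h1
  simp only [Set.mem_compl_iff, Set.mem_ofPred_eq, not_le] at hx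
  exact hx.le

theorem lintegral_sq_expMeasure : ∫⁻ x, ENNReal.ofReal (x ^ 2) ∂expMeasure 1 = 2 := by
  have h1 : ∫⁻ x, ENNReal.ofReal (x ^ 2) ∂expMeasure 1
      = ∫⁻ x, exponentialPDF 1 x * ENNReal.ofReal (x ^ 2) := by
    change ∫⁻ x, ENNReal.ofReal (x ^ 2) ∂(volume.withDensity (exponentialPDF 1)) = _
    rw [lintegral_withDensity_eq_lintegral_mul]
    · rfl
    · exact (measurable_exponentialPDFReal 1).ennreal_ofReal
    · fun_prop
  -- The square is written as the real power `3 - 1` to match the integral of `Γ(3) = 2`.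
  have h2 : ∫⁻ x, exponentialPDF 1 x * ENNReal.ofReal (x ^ 2)
      = ∫⁻ x in Set.Ioi 0, ENNReal.ofReal (Real.exp (-x) * x ^ ((3 : ℝ) - 1)) := by
    rw [← lintegral_indicator measurableSet_Ioi]
    refine lintegral_congr fun x => ?_
    by_cases hx : 0 < x
    · rw [Set.indicator_of_mem (Set.mem_Ioi.2 hx), exponentialPDF_of_nonneg hx.le,
        ← ENNReal.ofReal_mul (by positivity), one_mul, one_mul]
      congr 2
      rw [← Real.rpow_natCast]; norm_num
    · rw [Set.indicator_of_notMem (by simpa using hx)]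
      rcases (not_lt.1 hx).lt_or_eq with hx | rfl
      · rw [exponentialPDF_of_neg hx, zero_mul]
      · simp
  rw [h1, h2, ← ofReal_integral_eq_lintegral_ofReal (Real.GammaIntegral_convergent (by norm_num))]
  · rw [← Real.Gamma_eq_integral (by norm_num)]
    have : Real.Gamma 3 = 2 := by
      rw [show (3 : ℝ) = (2 : ℕ) + 1 by norm_num, Real.Gamma_nat_eq_factorial]
      norm_num [Nat.factorial]
    rw [this]; simp
  · refine (ae_restrict_iff' measurableSet_Ioi).2 (Eventually.of_forall fun x hx => ?_)
    have : (0 : ℝ) < x := hx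
    positivity

variable {ι : Type*}

/-- The smallest of the clocks in `S`. -/
noncomputable def minClock (S : Finset ι) (F : ι → ℝ) : ℝ := ⨅ i : S, F i

theorem minClock_le {S : Finset ι} {F : ι → ℝ} {i : ι} (hi : i ∈ S) : minClock S F ≤ F i :=
  ciInf_le (Set.finite_range _).bddBelow (⟨i, hi⟩ : S)

theorem exists_minClock_eq {S : Finset ι} (hS : S.Nonempty) (F : ι → ℝ) :
    ∃ i ∈ S, minClock S F = F i := by
  have : Nonempty S := hS.to_subtype
  obtain ⟨i, hi⟩ := exists_eq_ciInf_of_finite (f := fun i : S => F i)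
  exact ⟨i, i.2, hi.symm⟩

theorem lt_minClock_iff {S : Finset ι} (hS : S.Nonempty) {F : ι → ℝ} {t : ℝ} :
    t < minClock S F ↔ ∀ i ∈ S, t < F i := by
  constructor
  · intro h i hi; exact h.trans_le (minClock_le hi)
  · intro h
    obtain ⟨i, hi, hi'⟩ := exists_minClock_eq hS F
    rw [hi']; exact h i hi

theorem le_minClock_iff {S : Finset ι} (hS : S.Nonempty) {F : ι → ℝ} {t : ℝ} :
    t ≤ minClock S F ↔ ∀ i ∈ S, t ≤ F i := by
  constructor
  · intro h i hi; exact h.trans (minClock_le hi)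
  · intro h
    obtain ⟨i, hi, hi'⟩ := exists_minClock_eq hS F
    rw [hi']; exact h i hi

theorem minClock_le_iff {S : Finset ι} (hS : S.Nonempty) {F : ι → ℝ} {t : ℝ} :
    minClock S F ≤ t ↔ ∃ i ∈ S, F i ≤ t := by
  rw [← not_lt, lt_minClock_iff hS]; push Not; rfl

theorem minClock_nonneg {S : Finset ι} (hS : S.Nonempty) {F : ι → ℝ} (hF : ∀ i, 0 ≤ F i) :
    0 ≤ minClock S F := (le_minClock_iff hS).2 fun i _ => hF i

theorem measurable_minClock (S : Finset ι) : Measurable (minClock S) := by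
  unfold minClock
  exact Measurable.iInf fun i => measurable_pi_apply _

variable [Fintype ι]

/-- Independent exponential clocks with rate `r`. -/
noncomputable abbrev clocks (ι : Type*) [Fintype ι] (r : ℝ) : Measure (ι → ℝ) :=
  Measure.pi fun _ => expMeasure r

theorem isProbabilityMeasure_clocks {r : ℝ} (hr : 0 < r) :
    IsProbabilityMeasure (clocks ι r) := by
  have := isProbabilityMeasure_expMeasure hr
  infer_instance

instance : IsProbabilityMeasure (expMeasure 1) := isProbabilityMeasure_expMeasure one_pos

theorem clocks_ae_nonneg : ∀ᵐ F ∂clocks ι 1, ∀ i, 0 ≤ F i :=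
  ae_all_iff.2 fun i =>
    (measurePreserving_eval (fun _ : ι => expMeasure 1) i).quasiMeasurePreserving.ae
      (expMeasure_ae_nonneg one_pos)

theorem clocks_lt_minClock {S : Finset ι} (hS : S.Nonempty) {t : ℝ} (ht : 0 ≤ t) :
    (clocks ι 1).real {F | t < minClock S F} = Real.exp (-S.card * t) := by
  have h1 : {F : ι → ℝ | t < minClock S F} = Set.pi S fun _ => Set.Ioi t := by
    ext F; simp [lt_minClock_iff hS, Set.mem_pi]
  rw [measureReal_def, h1, Measure.pi_pi_finset, Finset.prod_const, expMeasure_Ioi one_pos ht,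
    ENNReal.toReal_pow, ENNReal.toReal_ofReal (Real.exp_nonneg _), ← Real.exp_nat_mul]
  congr 1; ring

theorem lintegral_clock_sq (i : ι) :
    ∫⁻ F : ι → ℝ, ENNReal.ofReal (F i ^ 2) ∂clocks ι 1 = 2 := by
  have h := (measurePreserving_eval (fun _ : ι => expMeasure 1) i).lintegral_comp
    (f := fun x => ENNReal.ofReal (x ^ 2)) (by fun_prop)
  rw [lintegral_sq_expMeasure] at h
  exact h

theorem lintegral_minClock_sq_le {S : Finset ι} (hS : S.Nonempty) :
    ∫⁻ F : ι → ℝ, ENNReal.ofReal (minClock S F ^ 2) ∂clocks ι 1 ≤ 2 := by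
  obtain ⟨i, hi⟩ := hS
  rw [← lintegral_clock_sq i]
  refine lintegral_mono_ae ?_
  filter_upwards [clocks_ae_nonneg] with F hF
  exact ENNReal.ofReal_le_ofReal (pow_le_pow_left₀ (minClock_nonneg ⟨i, hi⟩ hF)
    (minClock_le hi) 2)

theorem memLp_minClock {S : Finset ι} (hS : S.Nonempty) : MemLp (minClock S) 2 (clocks ι 1) := by
  rw [memLp_two_iff_integrable_sq (measurable_minClock S).aestronglyMeasurable]
  refine ⟨((measurable_minClock S).pow_const 2).aestronglyMeasurable, ?_⟩
  rw [hasFiniteIntegral_iff_ofReal (Eventually.of_forall fun F => sq_nonneg _)]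
  exact (lintegral_minClock_sq_le hS).trans_lt (by simp)

theorem integrable_minClock {S : Finset ι} (hS : S.Nonempty) :
    Integrable (minClock S) (clocks ι 1) := (memLp_minClock hS).integrable (by norm_num)

theorem integrable_minClock_mul {S T : Finset ι} (hS : S.Nonempty) (hT : T.Nonempty) :
    Integrable (fun F => minClock S F * minClock T F) (clocks ι 1) :=
  (memLp_minClock hS).integrable_mul (memLp_minClock hT)

theorem integral_minClock {S : Finset ι} (hS : S.Nonempty) :
    ∫ F, minClock S F ∂clocks ι 1 = 1 / S.card := by
  have hc : (0 : ℝ) < S.card := by exact_mod_cast hS.card_pos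
  rw [(integrable_minClock hS).integral_eq_integral_meas_lt]
  · rw [setIntegral_congr_fun measurableSet_Ioi fun t ht =>
      clocks_lt_minClock hS (le_of_lt ht), integral_exp_mul_Ioi (by linarith)]
    simp [neg_div_neg_eq]
  · filter_upwards [clocks_ae_nonneg] with F hF
    exact minClock_nonneg hS hF

theorem integral_minClock_sq_le {S : Finset ι} (hS : S.Nonempty) :
    ∫ F, minClock S F ^ 2 ∂clocks ι 1 ≤ 2 := by
  rw [integral_eq_lintegral_of_nonneg_ae (Eventually.of_forall fun F => sq_nonneg _)
    ((measurable_minClock S).pow_const 2).aestronglyMeasurable]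
  exact ENNReal.toReal_le_of_le_ofReal (by norm_num) (by
    simpa using lintegral_minClock_sq_le hS)

/-- A bound without any disjointness: each minimum is at most a single clock, whose second moment is
`2`. -/
theorem integral_minClock_mul_le {S T : Finset ι} (hS : S.Nonempty) (hT : T.Nonempty) :
    ∫ F, minClock S F * minClock T F ∂clocks ι 1 ≤ 2 := by
  have h1 := (memLp_minClock hS).integrable_sq
  have h2 := (memLp_minClock hT).integrable_sq
  calc ∫ F, minClock S F * minClock T F ∂clocks ι 1
      ≤ ∫ F, (1 / 2 * minClock S F ^ 2 + 1 / 2 * minClock T F ^ 2) ∂clocks ι 1 := by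
        refine integral_mono (integrable_minClock_mul hS hT)
          ((h1.const_mul _).add (h2.const_mul _)) fun F => ?_
        simp only
        nlinarith [sq_nonneg (minClock S F - minClock T F)]
    _ ≤ 2 := by
        rw [integral_add (h1.const_mul _) (h2.const_mul _), integral_const_mul, integral_const_mul]
        linarith [integral_minClock_sq_le hS, integral_minClock_sq_le hT]

theorem integral_minClock_mul_of_disjoint {S T : Finset ι} (hS : S.Nonempty) (hT : T.Nonempty)
    (hST : Disjoint S T) :
    ∫ F, minClock S F * minClock T F ∂clocks ι 1 = 1 / S.card * (1 / T.card) := by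
  have h1 : iIndepFun (fun (i : ι) (F : ι → ℝ) => F i) (clocks ι 1) :=
    iIndepFun_pi (X := fun _ x => x) fun i => aemeasurable_id
  have h2 := h1.indepFun_finset S T hST fun i => measurable_pi_apply i
  have hm : ∀ U : Finset ι, Measurable fun y : U → ℝ => ⨅ i : U, y i := fun U =>
    Measurable.iInf fun i => measurable_pi_apply _
  have h3 : IndepFun (minClock S) (minClock T) (clocks ι 1) := h2.comp (hm S) (hm T)
  have h4 := h3.integral_mul_eq_mul_integral (measurable_minClock S).aestronglyMeasurable
    (measurable_minClock T).aestronglyMeasurable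
  rw [integral_minClock hS, integral_minClock hT] at h4
  exact h4

/-- Given the fireproofing clocks, the probability is at most `r` times their minimum over `S`, and
this minimum has mean `1 / S.card`. -/
theorem clocks_forall_le_le {r : ℝ} (hr : 0 < r) {S : Finset ι} (hS : S.Nonempty) (j : ι) :
    ((clocks ι 1).prod (clocks ι r)) {x | ∀ w ∈ S, x.2 j ≤ x.1 w}
      ≤ ENNReal.ofReal (r / S.card) := by
  have := isProbabilityMeasure_expMeasure hr
  have h1 : {x : (ι → ℝ) × (ι → ℝ) | ∀ w ∈ S, x.2 j ≤ x.1 w}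
      = {x | x.2 j ≤ minClock S x.1} := by
    ext x; simp [le_minClock_iff hS]
  have h2 : MeasurableSet {x : (ι → ℝ) × (ι → ℝ) | x.2 j ≤ minClock S x.1} :=
    measurableSet_le ((measurable_pi_apply j).comp measurable_snd)
      ((measurable_minClock S).comp measurable_fst)
  rw [h1, Measure.prod_apply h2]
  calc ∫⁻ F, clocks ι r (Prod.mk F ⁻¹' {x | x.2 j ≤ minClock S x.1}) ∂clocks ι 1
      ≤ ∫⁻ F, ENNReal.ofReal (r * minClock S F) ∂clocks ι 1 := by
        refine lintegral_mono_ae ?_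
        filter_upwards [clocks_ae_nonneg] with F hF
        have h3 : Prod.mk F ⁻¹' {x : (ι → ℝ) × (ι → ℝ) | x.2 j ≤ minClock S x.1}
            = Function.eval j ⁻¹' Set.Iic (minClock S F) := by ext I; simp
        rw [h3, (measurePreserving_eval (fun _ : ι => expMeasure r) j).measure_preimage
          measurableSet_Iic.nullMeasurableSet]
        exact expMeasure_Iic_le hr (minClock_nonneg hS hF)
    _ = ENNReal.ofReal (r / S.card) := by
        rw [← ofReal_integral_eq_lintegral_ofReal ((integrable_minClock hS).const_mul r),
          integral_const_mul, integral_minClock hS]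
        · congr 1; ring
        · filter_upwards [clocks_ae_nonneg] with F hF
          exact mul_nonneg hr.le (minClock_nonneg hS hF)

/-- Given the fireproofing clocks, the events concern distinct ignition clocks, hence are
independent; the product of the exponential tails is the exponential of a sum. -/
theorem clocks_forall_exists_le_le {α : Type*} {r : ℝ} (hr : 0 < r) (A : Finset α) {e : α → ι}
    (he : Set.InjOn e A) {S : α → Finset ι} (hS : ∀ v ∈ A, (S v).Nonempty) :
    ((clocks ι 1).prod (clocks ι r)) {x | ∀ v ∈ A, ∃ w ∈ S v, x.1 w ≤ x.2 (e v)}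
      ≤ ∫⁻ F, ENNReal.ofReal (Real.exp (-(r * ∑ v ∈ A, minClock (S v) F))) ∂clocks ι 1 := by
  classical
  have := isProbabilityMeasure_expMeasure hr
  have h1 : {x : (ι → ℝ) × (ι → ℝ) | ∀ v ∈ A, ∃ w ∈ S v, x.1 w ≤ x.2 (e v)}
      = ⋂ v ∈ A, {x | minClock (S v) x.1 ≤ x.2 (e v)} := by
    ext x
    simp only [Set.mem_ofPred_eq, Set.mem_iInter]
    exact forall₂_congr fun v hv => (minClock_le_iff (hS v hv)).symm
  have h2 : MeasurableSet
      (⋂ v ∈ A, {x : (ι → ℝ) × (ι → ℝ) | minClock (S v) x.1 ≤ x.2 (e v)}) :=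
    Finset.measurableSet_biInter _ fun v _ =>
      measurableSet_le ((measurable_minClock (S v)).comp measurable_fst)
        ((measurable_pi_apply _).comp measurable_snd)
  rw [h1, Measure.prod_apply h2]
  refine lintegral_mono_ae ?_
  filter_upwards [clocks_ae_nonneg] with F hF
  rcases A.eq_empty_or_nonempty with rfl | ⟨v0, hv0⟩
  · have := isProbabilityMeasure_clocks (ι := ι) hr
    simp
  have : Nonempty α := ⟨v0⟩
  have hinv : ∀ v ∈ A, Function.invFunOn e A (e v) = v := fun v hv =>
    he.leftInvOn_invFunOn hv
  have h3 : Prod.mk F ⁻¹' ⋂ v ∈ A, {x : (ι → ℝ) × (ι → ℝ) | minClock (S v) x.1 ≤ x.2 (e v)}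
      = Set.pi (A.image e) fun j => Set.Ici (minClock (S (Function.invFunOn e A j)) F) := by
    ext I
    simp only [Set.mem_preimage, Set.mem_iInter, Set.mem_ofPred_eq, Set.mem_pi, Set.mem_Ici,
      Finset.coe_image, Set.forall_mem_image, Finset.mem_coe]
    exact forall₂_congr fun v hv => by rw [hinv v hv]
  rw [h3, Measure.pi_pi_finset, Finset.prod_image he,
    Finset.prod_congr rfl fun v hv => by
      rw [hinv v hv, expMeasure_Ici hr (minClock_nonneg (hS v hv) hF)],
    ← ENNReal.ofReal_prod_of_nonneg fun v _ => Real.exp_nonneg _, ← Real.exp_sum,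
    Finset.mul_sum, Finset.sum_neg_distrib]

/-- Chebyshev in pointwise form: either `W ≥ c / 2`, or `(W - c) ^ 2 ≥ c ^ 2 / 4` and the second
term is already at least `1`. -/
theorem lintegral_exp_neg_le {Ω : Type*} [MeasurableSpace Ω] {ν : Measure Ω}
    [IsProbabilityMeasure ν] {W : Ω → ℝ} (hW : MemLp W 2 ν) (hW0 : ∀ᵐ x ∂ν, 0 ≤ W x) {r c : ℝ}
    (hr : 0 ≤ r) (hc : 0 < c) :
    ∫⁻ x, ENNReal.ofReal (Real.exp (-(r * W x))) ∂ν
      ≤ ENNReal.ofReal (Real.exp (-(r * c / 2)) + 4 / c ^ 2 * ∫ x, (W x - c) ^ 2 ∂ν) := by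
  have h1 : Integrable (fun x => (W x - c) ^ 2) ν := (hW.sub (memLp_const c)).integrable_sq
  have h2 : Integrable (fun x => Real.exp (-(r * c / 2)) + 4 / c ^ 2 * (W x - c) ^ 2) ν :=
    (integrable_const _).add (h1.const_mul _)
  calc ∫⁻ x, ENNReal.ofReal (Real.exp (-(r * W x))) ∂ν
      ≤ ∫⁻ x, ENNReal.ofReal (Real.exp (-(r * c / 2)) + 4 / c ^ 2 * (W x - c) ^ 2) ∂ν := by
        refine lintegral_mono_ae ?_
        filter_upwards [hW0] with x hx
        refine ENNReal.ofReal_le_ofReal ?_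
        rcases le_total (c / 2) (W x) with h | h
        · have : Real.exp (-(r * W x)) ≤ Real.exp (-(r * c / 2)) :=
            Real.exp_le_exp.2 (by nlinarith)
          have : 0 ≤ 4 / c ^ 2 * (W x - c) ^ 2 := by positivity
          linarith
        · have h3 : Real.exp (-(r * W x)) ≤ 1 := Real.exp_le_one_iff.2 (by nlinarith)
          have h4 : 1 ≤ 4 / c ^ 2 * (W x - c) ^ 2 := by
            rw [div_mul_eq_mul_div, le_div_iff₀ (by positivity)]; nlinarith
          have := Real.exp_nonneg (-(r * c / 2))
          linarith
    _ = _ := by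
        rw [← ofReal_integral_eq_lintegral_ofReal h2 (Eventually.of_forall fun x => by positivity),
          integral_add (integrable_const _) (h1.const_mul _), integral_const_mul]
        simp

theorem integral_sum_minClock_sub_sq {α : Type*} (A : Finset α) {S : α → Finset ι}
    (hS : ∀ v ∈ A, (S v).Nonempty) (c : ℝ) :
    ∫ F, (∑ v ∈ A, minClock (S v) F - c) ^ 2 ∂clocks ι 1
      = ∑ v ∈ A, ∑ w ∈ A, ∫ F, minClock (S v) F * minClock (S w) F ∂clocks ι 1
        - 2 * c * ∑ v ∈ A, (1 / (S v).card : ℝ) + c ^ 2 := by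
  have h1 : ∀ F : ι → ℝ, (∑ v ∈ A, minClock (S v) F - c) ^ 2
      = ∑ v ∈ A, ∑ w ∈ A, minClock (S v) F * minClock (S w) F
        - 2 * c * ∑ v ∈ A, minClock (S v) F + c ^ 2 := by
    intro F
    rw [← Finset.sum_mul_sum]; ring
  have i1 : ∀ v ∈ A, ∀ w ∈ A, Integrable (fun F => minClock (S v) F * minClock (S w) F)
      (clocks ι 1) := fun v hv w hw => integrable_minClock_mul (hS v hv) (hS w hw)
  have i2 : ∀ v ∈ A, Integrable (fun F => ∑ w ∈ A, minClock (S v) F * minClock (S w) F)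
      (clocks ι 1) := fun v hv => integrable_finsetSum _ (i1 v hv)
  have i3 : Integrable (fun F => ∑ v ∈ A, minClock (S v) F) (clocks ι 1) :=
    integrable_finsetSum _ fun v hv => integrable_minClock (hS v hv)
  have i4 : Integrable (fun F => ∑ v ∈ A, ∑ w ∈ A, minClock (S v) F * minClock (S w) F
      - 2 * c * ∑ v ∈ A, minClock (S v) F) (clocks ι 1) :=
    (integrable_finsetSum _ i2).sub (i3.const_mul _)
  simp_rw [h1]
  rw [integral_add i4 (integrable_const _),
    integral_sub (integrable_finsetSum _ i2) (i3.const_mul _), integral_const_mul,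
    integral_finsetSum _ i2, integral_finsetSum _ fun v hv => integrable_minClock (hS v hv),
    Finset.sum_congr rfl fun v hv => integral_finsetSum _ (i1 v hv),
    Finset.sum_congr rfl fun v hv => integral_minClock (hS v hv)]
  simp

end Clocks

/-! ### Paths to the roots: lengths and disjointness -/

section PathAbove

variable {V : Type*} [Fintype V] [DecidableEq V]

theorem exists_mem_level {P : Finset V} {h : V → V} (hh : h ∈ rootedForests P) (v : V) :
    ∃ k, ∃ q ∈ P, v ∈ level P h q k := by
  obtain ⟨k, hk, hk'⟩ := exists_first_iterate (p := fun w => w ∈ P)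
    ((mem_rootedForests.1 hh).2 v)
  exact ⟨k, _, hk, mem_level.2 ⟨rfl, hk'⟩⟩

theorem card_pathAbove {P : Finset V} {h : V → V} (hh : h ∈ rootedForests P) {q v : V} {k : ℕ}
    (hq : q ∈ P) (hv : v ∈ level P h q k) : (pathAbove P h v).card = k := by
  obtain ⟨hP, -⟩ := mem_rootedForests.1 hh
  obtain ⟨h1, h2⟩ := mem_level.1 hv
  have h3 : pathAbove P h v = (Finset.range k).image fun i => h^[i] v := by
    ext w
    rw [mem_pathAbove, Finset.mem_image]
    constructor
    · rintro ⟨hw, i, rfl⟩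
      refine ⟨i, Finset.mem_range.2 ?_, rfl⟩
      by_contra hik
      rw [iterate_eq_of_mem hP (not_lt.1 hik) (h1 ▸ hq), h1] at hw
      exact hw hq
    · rintro ⟨i, hi, rfl⟩
      exact ⟨h2 i (Finset.mem_range.1 hi), i, rfl⟩
  have key : ∀ i j, i < j → j < k → h^[i] v ≠ h^[j] v := by
    intro i j hij hj heq
    refine iterate_succ_ne_self hh (h2 i (by omega)) (j - i - 1) ?_
    rw [← Function.iterate_add_apply, heq]
    congr 2; omega
  rw [h3, Finset.card_image_of_injOn, Finset.card_range]
  intro i hi j hj heq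
  have hi' := Finset.mem_range.1 (Finset.mem_coe.1 hi)
  have hj' := Finset.mem_range.1 (Finset.mem_coe.1 hj)
  rcases lt_trichotomy i j with h | h | h
  · exact absurd heq (key i j h hj')
  · exact h
  · exact absurd heq.symm (key j i h hi')

theorem level_disjoint {P : Finset V} {h : V → V} (hh : h ∈ rootedForests P) {q q' : V} {k k' : ℕ}
    (hq : q ∈ P) (hq' : q' ∈ P) (hne : (k, q) ≠ (k', q')) :
    Disjoint (level P h q k) (level P h q' k') := by
  rw [Finset.disjoint_left]
  intro v hv hv'
  have hk : k = k' := (card_pathAbove hh hq hv).symm.trans (card_pathAbove hh hq' hv')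
  subst hk
  exact hne (by rw [← (mem_level.1 hv).1, ← (mem_level.1 hv').1])

theorem disjoint_pathAbove {P : Finset V} {h : V → V} (hh : h ∈ rootedForests P) {q q' v v' : V}
    {k k' : ℕ} (hq : q ∈ P) (hq' : q' ∈ P) (hne : q ≠ q') (hv : v ∈ level P h q k)
    (hv' : v' ∈ level P h q' k') : Disjoint (pathAbove P h v) (pathAbove P h v') := by
  obtain ⟨hP, hr⟩ := mem_rootedForests.1 hh
  rw [Finset.disjoint_left]
  intro w hw hw'
  obtain ⟨hwP, i, hi⟩ := mem_pathAbove.1 hw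
  obtain ⟨-, j, hj⟩ := mem_pathAbove.1 hw'
  obtain ⟨t, ht⟩ := hr w
  have h1 : h^[t + i] v = h^[t] w := by rw [Function.iterate_add_apply, hi]
  have h2 : h^[t + j] v' = h^[t] w := by rw [Function.iterate_add_apply, hj]
  have h3 := (mem_level.1 hv).1
  have h4 := (mem_level.1 hv').1
  refine hne ?_
  rw [← h3, ← h4, iterate_unique_of_mem hP (i := k) (j := t + i) (h3 ▸ hq) (h1 ▸ ht), h1, ← h2]
  exact iterate_unique_of_mem hP (h2 ▸ ht) (h4 ▸ hq')

theorem nonempty_pathAbove {P : Finset V} {h : V → V} {v : V} (hv : v ∉ P) :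
    (pathAbove P h v).Nonempty := ⟨v, mem_pathAbove.2 ⟨hv, 0, rfl⟩⟩

theorem freeze_mem_rootedForests {P Q : Finset V} {p : V → V} (hp : p ∈ rootedForests P)
    (hPQ : P ⊆ Q) : freeze p Q ∈ rootedForests Q := by
  refine mem_rootedForests.2 ⟨fun a ha => if_pos ha, fun v => ?_⟩
  obtain ⟨k, hk, hk'⟩ := exists_first_iterate (h := p) (v := v) (p := fun w => w ∈ Q)
    (((mem_rootedForests.1 hp).2 v).imp fun k hk => hPQ hk)
  exact ⟨k, by rwa [iterate_freeze hk']⟩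

/-- Since `P` is closed under `p`, an orbit that enters `P` never leaves it, so freezing `P` does
not change the part outside. -/
theorem pathAbove_freeze {P : Finset V} {p : V → V} (hcl : ∀ x ∈ P, p x ∈ P) (v : V) :
    pathAbove P (freeze p P) v = pathAbove P p v := by
  have hcl' : ∀ x ∈ P, freeze p P x ∈ P := fun x hx => by rw [freeze, if_pos hx]; exact hx
  have h1 : ∀ (g : V → V), (∀ x ∈ P, g x ∈ P) → ∀ i, g^[i] v ∉ P → ∀ j < i, g^[j] v ∉ P := by
    intro g hg i hi j hj hmem
    obtain ⟨d, rfl⟩ := Nat.exists_eq_add_of_le hj.le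
    rw [add_comm, Function.iterate_add_apply] at hi
    exact hi (iterate_mem_of_closed hg hmem d)
  have h2 : ∀ i, (freeze p P)^[i] v ∉ P → p^[i] v = (freeze p P)^[i] v := by
    intro i
    induction i with
    | zero => intro _; rfl
    | succ i ih =>
      intro hi
      have h3 := h1 _ hcl' _ hi i (Nat.lt_succ_self i)
      rw [Function.iterate_succ_apply', Function.iterate_succ_apply', ih h3, freeze,
        if_neg h3]
  ext w
  rw [mem_pathAbove, mem_pathAbove]
  constructor
  · rintro ⟨hw, i, rfl⟩
    exact ⟨hw, i, h2 i hw⟩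
  · rintro ⟨hw, i, rfl⟩
    exact ⟨hw, i, iterate_freeze (h1 p hcl i hw)⟩

theorem sum_eq_sum_level {P : Finset V} {h : V → V} (hh : h ∈ rootedForests P) (s : Finset ℕ)
    (f : V → ℝ) :
    ∑ v ∈ (s ×ˢ P).biUnion (fun x => level P h x.2 x.1), f v
      = ∑ k ∈ s, ∑ q ∈ P, ∑ v ∈ level P h q k, f v := by
  rw [Finset.sum_biUnion, Finset.sum_product]
  intro x hx y hy hne
  have hx' := Finset.mem_product.1 (Finset.mem_coe.1 hx)
  have hy' := Finset.mem_product.1 (Finset.mem_coe.1 hy)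
  exact level_disjoint hh hx'.2 hy'.2 hne

theorem addOrbit_closed {p : V → V} {P : Finset V} (hP : ∀ x ∈ P, p x ∈ P) (u : V) :
    ∀ x ∈ addOrbit P p u, p x ∈ addOrbit P p u := by
  intro x hx
  rcases mem_addOrbit.1 hx with hx | ⟨i, rfl⟩
  · exact mem_addOrbit.2 (Or.inl (hP x hx))
  · exact mem_addOrbit.2 (Or.inr ⟨i + 1, Function.iterate_succ_apply' p i u⟩)

end PathAbove

/-! ### Connection probabilities given the tree -/

section SectionBounds

variable {V : Type*} [Fintype V] [DecidableEq V]

/-- The expected number, up to a factor, of fires that reach the vertices `P`. -/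
noncomputable def fireMean (P : Finset V) (h : V → V) : ℝ :=
  P.card + ∑ k ∈ Finset.Icc 1 (Fintype.card V), (1 / k : ℝ) *
    ∑ q ∈ P, ((level P h q k).card : ℝ)

theorem fireMean_nonneg (P : Finset V) (h : V → V) : 0 ≤ fireMean P h :=
  add_nonneg (Nat.cast_nonneg _) (Finset.sum_nonneg fun _ _ =>
    mul_nonneg (by positivity) (Finset.sum_nonneg fun _ _ => Nat.cast_nonneg _))

theorem sum_one_div_card_pathAbove_le {P : Finset V} {h : V → V} (hh : h ∈ rootedForests P) :
    ∑ v ∈ Pᶜ, (1 / (pathAbove P h v).card : ℝ)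
      ≤ ∑ k ∈ Finset.Icc 1 (Fintype.card V), (1 / k : ℝ) *
        ∑ q ∈ P, ((level P h q k).card : ℝ) := by
  have h1 : Pᶜ ⊆ (Finset.Icc 1 (Fintype.card V) ×ˢ P).biUnion fun x => level P h x.2 x.1 := by
    intro v hv
    obtain ⟨k, q, hq, hk⟩ := exists_mem_level hh v
    have hc := card_pathAbove hh hq hk
    refine Finset.mem_biUnion.2 ⟨(k, q), Finset.mem_product.2 ⟨Finset.mem_Icc.2 ⟨?_, ?_⟩, hq⟩, hk⟩
    · rw [← hc]; exact (nonempty_pathAbove (Finset.mem_compl.1 hv)).card_pos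
    · rw [← hc]; exact Finset.card_le_univ _
  refine (Finset.sum_le_sum_of_subset_of_nonneg h1 fun _ _ _ => by positivity).trans ?_
  rw [sum_eq_sum_level hh]
  refine Finset.sum_le_sum fun k _ => ?_
  rw [Finset.mul_sum]
  refine Finset.sum_le_sum fun q hq => ?_
  rw [Finset.sum_congr rfl fun v hv => by rw [card_pathAbove hh hq hv], Finset.sum_const,
    nsmul_eq_mul, mul_comm]

variable {p : V → V} {ρ : V}

theorem card_image_parentEdge (hp : p ∈ rootedForests {ρ}) {S : Finset V} (hS : ρ ∉ S) :
    (S.image fun v => s(v, p v)).card = S.card :=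
  Finset.card_image_of_injOn fun v hv w _ hvw =>
    parentEdge_injective hp (by rintro rfl; exact hS hv) hvw

/-- The probability that two vertices are not in the same component, given the tree. -/
theorem clocks_not_sameComponent_le (hp : p ∈ rootedForests {ρ}) (u : V) {r : ℝ} (hr : 0 < r) :
    ((clocks (Sym2 V) 1).prod (clocks (Sym2 V) r)).real
        {x | ¬ SameComponent (parentForest p x.1 x.2) u ρ}
      ≤ r * fireMean (addOrbit {ρ} p u) (freeze p (addOrbit {ρ} p u)) := by
  set P := addOrbit {ρ} p u with hP
  have hρ : ρ ∈ P := mem_addOrbit.2 (Or.inl (Finset.mem_singleton_self ρ))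
  have hcl : ∀ x ∈ P, p x ∈ P := addOrbit_closed (fun x hx => by
    rw [Finset.mem_singleton] at hx ⊢; rw [hx, apply_root hp]) u
  set e : V → Sym2 V := fun v => s(v, p v) with he
  -- The second union includes `ρ`, whose pair `s(ρ, ρ)` is not an edge but carries clocks; this
  -- only enlarges the union.
  have h1 : {x : (Sym2 V → ℝ) × (Sym2 V → ℝ) | ¬ SameComponent (parentForest p x.1 x.2) u ρ}
      ⊆ (⋃ v ∈ Pᶜ, {x | ∀ w ∈ (pathAbove P p v).image e, x.2 (e v) ≤ x.1 w})
        ∪ ⋃ v ∈ P, {x | ∀ w ∈ ({e v} : Finset (Sym2 V)), x.2 (e v) ≤ x.1 w} := by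
    intro x hx
    by_contra hx'
    refine hx (sameComponent_of_forall_exists_lt hp (fun v hv => ?_) fun v hv _ => ?_)
    · by_contra! hle
      exact hx' (Or.inl (Set.mem_biUnion (Finset.mem_coe.2 (Finset.mem_compl.2 hv))
        (Finset.forall_mem_image.2 hle)))
    · by_contra! hle
      refine hx' (Or.inr (Set.mem_biUnion (Finset.mem_coe.2 hv) fun w hw => ?_))
      rw [Finset.mem_singleton.1 hw]
      exact hle
  refine ENNReal.toReal_le_of_le_ofReal (mul_nonneg hr.le (fireMean_nonneg _ _))
    ((measure_mono h1).trans ((measure_union_le _ _).trans ?_))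
  have hS : ∀ v ∈ Pᶜ, ((pathAbove P p v).image e).Nonempty := fun v hv =>
    (nonempty_pathAbove (Finset.mem_compl.1 hv)).image e
  calc _ ≤ ∑ v ∈ Pᶜ, ENNReal.ofReal (r / ((pathAbove P p v).image e).card)
        + ∑ v ∈ P, ENNReal.ofReal (r / ({e v} : Finset (Sym2 V)).card) :=
        add_le_add
          ((measure_biUnion_finset_le _ _).trans
            (Finset.sum_le_sum fun v hv => clocks_forall_le_le hr (hS v hv) (e v)))
          ((measure_biUnion_finset_le _ _).trans
            (Finset.sum_le_sum fun v _ =>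
              clocks_forall_le_le hr (Finset.singleton_nonempty (e v)) (e v)))
    _ = ENNReal.ofReal (r * (P.card + ∑ v ∈ Pᶜ, (1 / (pathAbove P (freeze p P) v).card : ℝ))) := by
        rw [← ENNReal.ofReal_sum_of_nonneg fun _ _ => by positivity,
          ← ENNReal.ofReal_sum_of_nonneg fun _ _ => by positivity,
          ← ENNReal.ofReal_add (Finset.sum_nonneg fun _ _ => by positivity)
            (Finset.sum_nonneg fun _ _ => by positivity)]
        congr 1
        rw [mul_add, Finset.mul_sum, add_comm]
        congr 1
        · simp [mul_comm]
        · refine Finset.sum_congr rfl fun v _ => ?_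
          rw [pathAbove_freeze hcl, card_image_parentEdge hp fun h => (mem_pathAbove.1 h).1 hρ]
          ring
    _ ≤ _ := by
        refine ENNReal.ofReal_le_ofReal (mul_le_mul_of_nonneg_left ?_ hr.le)
        unfold fireMean
        gcongr
        exact sum_one_div_card_pathAbove_le (freeze_mem_rootedForests hp
          (Finset.singleton_subset_iff.2 hρ))

/-- The probability that two vertices are in the same component, given the tree. -/
theorem clocks_sameComponent_le (hp : p ∈ rootedForests {ρ}) (u : V) {r : ℝ} (hr : 0 < r) {K : ℕ}
    (hK : 0 < harmonicSum K) :
    ((clocks (Sym2 V) 1).prod (clocks (Sym2 V) r)).real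
        {x | SameComponent (parentForest p x.1 x.2) u ρ}
      ≤ Real.exp (-(r * ((addOrbit {ρ} p u).card * harmonicSum K) / 2))
        + 4 / ((addOrbit {ρ} p u).card * harmonicSum K) ^ 2
          * deviation K (addOrbit {ρ} p u) (freeze p (addOrbit {ρ} p u)) := by
  set P := addOrbit {ρ} p u with hP
  have hρ : ρ ∈ P := mem_addOrbit.2 (Or.inl (Finset.mem_singleton_self ρ))
  have hcl : ∀ x ∈ P, p x ∈ P := addOrbit_closed (fun x hx => by
    rw [Finset.mem_singleton] at hx ⊢; rw [hx, apply_root hp]) u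
  set h := freeze p P with hh
  have hhP : h ∈ rootedForests P :=
    freeze_mem_rootedForests hp (Finset.singleton_subset_iff.2 hρ)
  set e : V → Sym2 V := fun v => s(v, p v) with he
  set S : V → Finset (Sym2 V) := fun v => (pathAbove P h v).image e with hSdef
  set A := (Finset.Icc 1 K ×ˢ P).biUnion fun x => level P h x.2 x.1 with hA
  set c : ℝ := P.card * harmonicSum K with hc
  have hc0 : 0 < c := mul_pos (by exact_mod_cast Finset.card_pos.2 ⟨ρ, hρ⟩) hK
  have hAP : ∀ v ∈ A, v ∉ P := by
    intro v hv
    obtain ⟨x, hx, hx'⟩ := Finset.mem_biUnion.1 hv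
    have := (Finset.mem_Icc.1 (Finset.mem_product.1 hx).1).1
    exact (mem_level.1 hx').2 0 (by omega)
  have hS : ∀ v ∈ A, (S v).Nonempty := fun v hv => (nonempty_pathAbove (hAP v hv)).image e
  have hinj : ∀ T : Finset V, (∀ v ∈ T, v ∉ P) → Set.InjOn e T := fun T hT v hv w _ hvw =>
    parentEdge_injective hp (by rintro rfl; exact hT _ hv hρ) hvw
  have hcardS : ∀ k, ∀ q ∈ P, ∀ v ∈ level P h q k, (S v).card = k := by
    intro k q hq v hv
    rw [hSdef, card_image_parentEdge hp fun h => (mem_pathAbove.1 h).1 hρ]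
    exact card_pathAbove hhP hq hv
  have h1 : {x : (Sym2 V → ℝ) × (Sym2 V → ℝ) | SameComponent (parentForest p x.1 x.2) u ρ}
      ⊆ {x | ∀ v ∈ A, ∃ w ∈ S v, x.1 w ≤ x.2 (e v)} := by
    intro x hx v hv
    obtain ⟨w, hw, hw'⟩ := exists_le_of_sameComponent hp hx (hAP v hv)
    rw [← hP, ← pathAbove_freeze hcl] at hw
    exact ⟨e w, Finset.mem_image_of_mem e hw, hw'⟩
  have hW : MemLp (fun F => ∑ v ∈ A, minClock (S v) F) 2 (clocks (Sym2 V) 1) :=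
    memLp_finsetSum _ fun v hv => memLp_minClock (hS v hv)
  have hW0 : ∀ᵐ F ∂clocks (Sym2 V) 1, 0 ≤ ∑ v ∈ A, minClock (S v) F := by
    filter_upwards [clocks_ae_nonneg] with F hF
    exact Finset.sum_nonneg fun v hv => minClock_nonneg (hS v hv) hF
  refine (ENNReal.toReal_le_of_le_ofReal (by positivity) ((measure_mono h1).trans
    ((clocks_forall_exists_le_le hr A (hinj A hAP) hS).trans
      (lintegral_exp_neg_le hW hW0 hr.le hc0)))).trans ?_
  gcongr
  rw [integral_sum_minClock_sub_sq A hS]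
  unfold deviation
  rw [← hc, hA, sum_eq_sum_level hhP, sum_eq_sum_level hhP]
  have e1 : ∑ k ∈ Finset.Icc 1 K, ∑ q ∈ P, ∑ v ∈ level P h q k, (1 / (S v).card : ℝ)
      = ∑ k ∈ Finset.Icc 1 K, (1 / k : ℝ) * ∑ q ∈ P, ((level P h q k).card : ℝ) := by
    refine Finset.sum_congr rfl fun k _ => ?_
    rw [Finset.mul_sum]
    refine Finset.sum_congr rfl fun q hq => ?_
    rw [Finset.sum_congr rfl fun v hv => by rw [hcardS k q hq v hv], Finset.sum_const,
      nsmul_eq_mul, mul_comm]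
  rw [e1]
  gcongr
  rw [Finset.mul_sum, ← Finset.sum_add_distrib]
  refine Finset.sum_le_sum fun k hk => ?_
  have e2 : ∀ v, ∑ w ∈ (Finset.Icc 1 K ×ˢ P).biUnion (fun x => level P h x.2 x.1),
      ∫ F, minClock (S v) F * minClock (S w) F ∂clocks (Sym2 V) 1
      = ∑ j ∈ Finset.Icc 1 K, ∑ q' ∈ P, ∑ w ∈ level P h q' j,
        ∫ F, minClock (S v) F * minClock (S w) F ∂clocks (Sym2 V) 1 := fun v =>
    sum_eq_sum_level hhP _ _
  simp_rw [e2]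
  rw [Finset.sum_congr rfl fun q _ => Finset.sum_comm, Finset.sum_comm, Finset.mul_sum,
    ← Finset.sum_add_distrib]
  refine Finset.sum_le_sum fun j hj => ?_
  rw [Finset.mul_sum, Finset.mul_sum, ← Finset.sum_add_distrib]
  refine Finset.sum_le_sum fun q hq => ?_
  have hmemA : ∀ k ∈ Finset.Icc 1 K, ∀ q ∈ P, ∀ v ∈ level P h q k, v ∈ A := fun k hk q hq v hv =>
    Finset.mem_biUnion.2 ⟨(k, q), Finset.mem_product.2 ⟨hk, hq⟩, hv⟩
  -- Separate the pairs in the same tree from the others. In different trees the paths are disjoint,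
  -- so the product of minima has mean `1 / k * (1 / j)`; in the same tree the bound `2` is enough.
  rw [Finset.sum_comm, ← Finset.add_sum_erase _ _ hq, add_comm, Finset.mul_sum]
  refine add_le_add (Finset.sum_le_sum fun q' hq' => ?_) ?_
  · have hq'P := Finset.mem_of_mem_erase hq'
    apply le_of_eq
    have e3 : ∀ v ∈ level P h q k, ∀ w ∈ level P h q' j,
        ∫ F, minClock (S v) F * minClock (S w) F ∂clocks (Sym2 V) 1 = 1 / k * (1 / j) := by
      intro v hv w hw
      rw [integral_minClock_mul_of_disjoint (hS v (hmemA k hk q hq v hv))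
        (hS w (hmemA j hj q' hq'P w hw)), hcardS k q hq v hv, hcardS j q' hq'P w hw]
      have hd := disjoint_pathAbove hhP hq hq'P (Finset.ne_of_mem_erase hq').symm hv hw
      refine Finset.disjoint_left.2 fun x hx hx' => ?_
      obtain ⟨y, hy, rfl⟩ := Finset.mem_image.1 hx
      obtain ⟨z, hz, hzy⟩ := Finset.mem_image.1 hx'
      have : z = y := parentEdge_injective hp
        (by rintro rfl; exact (mem_pathAbove.1 hz).1 hρ) hzy
      subst this
      exact Finset.disjoint_left.1 hd hy hz
    rw [Finset.sum_congr rfl fun v hv => Finset.sum_congr rfl fun w hw => e3 v hv w hw]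
    simp only [Finset.sum_const, nsmul_eq_mul]
    ring
  · calc ∑ v ∈ level P h q k, ∑ w ∈ level P h q j,
        ∫ F, minClock (S v) F * minClock (S w) F ∂clocks (Sym2 V) 1
        ≤ ∑ v ∈ level P h q k, ∑ w ∈ level P h q j, 2 :=
          Finset.sum_le_sum fun v hv => Finset.sum_le_sum fun w hw =>
            integral_minClock_mul_le (hS v (hmemA k hk q hq v hv)) (hS w (hmemA j hj q hq w hw))
      _ = _ := by simp only [Finset.sum_const, nsmul_eq_mul]; ring

end SectionBounds

/-! ### Birthday sums and the length of the path -/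

section Survival

/-- The probability that `m` independent uniform elements of a set of size `n` are distinct. -/
noncomputable def distinctProb (n m : ℕ) : ℝ := (n.descFactorial m : ℝ) / (n : ℝ) ^ m

theorem distinctProb_nonneg (n m : ℕ) : 0 ≤ distinctProb n m := by
  unfold distinctProb; positivity

theorem distinctProb_le_one (n m : ℕ) : distinctProb n m ≤ 1 := by
  unfold distinctProb
  refine div_le_one_of_le₀ ?_ (by positivity)
  exact_mod_cast Nat.descFactorial_le_pow n m

theorem distinctProb_sub {n : ℕ} (hn : 0 < n) (m : ℕ) :
    distinctProb n m - distinctProb n (m + 1) = m / n * distinctProb n m := by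
  have hnR : (n : ℝ) ≠ 0 := by positivity
  unfold distinctProb
  rcases le_or_gt m n with hm | hm
  · rw [Nat.descFactorial_succ]
    push_cast [Nat.cast_sub hm]
    field_simp
    ring
  · rw [Nat.descFactorial_of_lt hm, Nat.descFactorial_of_lt (by omega)]; simp

/-- The term `m / n * distinctProb n m` is the probability that the first repetition occurs at draw
`m + 1`. -/
theorem sum_distinctProb_le_one {n : ℕ} (hn : 0 < n) (M : ℕ) :
    ∑ m ∈ Finset.range M, (m / n * distinctProb n m : ℝ) ≤ 1 := by
  simp_rw [← distinctProb_sub hn]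
  rw [Finset.sum_range_sub']
  linarith [distinctProb_nonneg n M, distinctProb_le_one n 0]

/-- The at most `√n` terms with index up to `√n` are at most `1` each; beyond that, the factor `√n *
(m / n) ≥ 1` is inserted and the repetition probabilities sum to at most `1`. -/
theorem sum_distinctProb_le {n : ℕ} (hn : 0 < n) (M : ℕ) :
    ∑ m ∈ Finset.range M, distinctProb n (m + 1) ≤ 2 * √n := by
  have hnR : (0 : ℝ) < n := by positivity
  have hs : 0 < √(n : ℝ) := Real.sqrt_pos.2 hnR
  have h1 : ∀ m ∈ Finset.range M, distinctProb n (m + 1) ≤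
      (if ((m + 1 : ℕ) : ℝ) ≤ √n then 1 else 0)
        + √n * (((m + 1 : ℕ) : ℝ) / n * distinctProb n (m + 1)) := by
    intro m _
    have h2 := distinctProb_nonneg n (m + 1)
    split_ifs with h
    · have : 0 ≤ √n * (((m + 1 : ℕ) : ℝ) / n * distinctProb n (m + 1)) := by positivity
      linarith [distinctProb_le_one n (m + 1)]
    · rw [zero_add]
      have h3 : (1 : ℝ) ≤ √n * (((m + 1 : ℕ) : ℝ) / n) := by
        rw [← mul_div_assoc, one_le_div hnR]
        calc (n : ℝ) = √n * √n := (Real.mul_self_sqrt hnR.le).symm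
          _ ≤ _ := by gcongr; exact (not_le.1 h).le
      calc distinctProb n (m + 1) = 1 * distinctProb n (m + 1) := (one_mul _).symm
        _ ≤ √n * (((m + 1 : ℕ) : ℝ) / n) * distinctProb n (m + 1) := by gcongr
        _ = _ := by ring
  refine (Finset.sum_le_sum h1).trans ?_
  rw [Finset.sum_add_distrib, ← Finset.mul_sum]
  have h4 : ∑ m ∈ Finset.range M, (if ((m + 1 : ℕ) : ℝ) ≤ √n then 1 else 0 : ℝ) ≤ √n := by
    rw [← Finset.sum_filter, Finset.sum_const, nsmul_eq_mul, mul_one]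
    have h5 : (Finset.range M).filter (fun m => ((m + 1 : ℕ) : ℝ) ≤ √n)
        ⊆ Finset.range ⌊√(n : ℝ)⌋₊ := by
      intro m hm
      rw [Finset.mem_range, Nat.lt_iff_add_one_le]
      exact Nat.le_floor (Finset.mem_filter.1 hm).2
    have h6 := Finset.card_le_card h5
    rw [Finset.card_range] at h6
    exact (Nat.cast_le.2 h6).trans (Nat.floor_le hs.le)
  have h7 : ∑ m ∈ Finset.range M, (((m + 1 : ℕ) : ℝ) / n * distinctProb n (m + 1)) ≤ 1 := by
    have := sum_distinctProb_le_one hn (M + 1)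
    rw [Finset.sum_range_succ'] at this
    simpa using this
  nlinarith

/-- Summation by parts reduces the sum to the tail sum of `sum_distinctProb_le`. -/
theorem sum_sq_distinctProb_le {n : ℕ} (hn : 0 < n) (M : ℕ) :
    ∑ m ∈ Finset.range M, ((m : ℝ) ^ 2 / n * distinctProb n m) ≤ 2 * √n := by
  refine le_trans ?_ (sum_distinctProb_le hn M)
  have h1 : ∑ m ∈ Finset.range M, ((m : ℝ) ^ 2 / n * distinctProb n m) + M * distinctProb n M
      = ∑ m ∈ Finset.range M, distinctProb n (m + 1) := by
    induction M with
    | zero => simp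
    | succ M ih =>
      rw [Finset.sum_range_succ, Finset.sum_range_succ, ← ih]
      have := distinctProb_sub hn M
      have h2 : (M : ℝ) ^ 2 / n * distinctProb n M = M * (M / n * distinctProb n M) := by ring
      rw [h2, ← this]
      push_cast; ring
  have := mul_nonneg (Nat.cast_nonneg M : (0 : ℝ) ≤ M) (distinctProb_nonneg n M)
  linarith

/-- A path of `m` vertices with a branch of length `k` attached has the same weight as a path of `m
+ k` vertices, up to explicit factors. This turns averages of level sizes into birthday sums. -/
theorem distinctProb_add {n m k : ℕ} (hm : 0 < m) :
    distinctProb n m * (m * levelMean n m k) = (m + k) * distinctProb n (m + k) := by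
  have h1 : (m : ℝ) ≠ 0 := by positivity
  unfold distinctProb levelMean
  rcases Nat.eq_zero_or_pos n with rfl | hn
  · have h3 : m ≠ 0 := hm.ne'
    simp [h3]
  have hnR : (n : ℝ) ≠ 0 := by positivity
  have h2 := Nat.descFactorial_mul_descFactorial (k := m) (m := m + k) (n := n) (by omega)
  rw [Nat.add_sub_cancel_left] at h2
  rw [← h2]
  push_cast
  rw [pow_add]
  field_simp

theorem levelMean_one {n k : ℕ} (hn : 0 < n) :
    levelMean n 1 k / n = ((k + 1 : ℕ) : ℝ) / n * distinctProb n (k + 1) := by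
  have hnR : (n : ℝ) ≠ 0 := by positivity
  have h := distinctProb_add (n := n) (m := 1) (k := k) one_pos
  have h1 : distinctProb n 1 = 1 := by simp [distinctProb, hnR]
  rw [h1, add_comm 1 k] at h
  have h2 : levelMean n 1 k = ((k : ℝ) + 1) * distinctProb n (k + 1) := by
    push_cast at h; linarith
  rw [h2]; push_cast; ring

theorem harmonicSum_eq (K : ℕ) : harmonicSum K = (harmonic K : ℝ) := by
  rw [harmonic_eq_sum_Icc, harmonicSum]
  push_cast
  simp

end Survival

/-! ### Averaging over the tree and the two vertices -/

section Average

variable {n : ℕ}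

theorem uniformOn_treeOf {ρ : Fin n} {p : Fin n → Fin n} (hp : p ∈ rootedForests {ρ}) :
    uniformOn {T : SimpleGraph (Fin n) | T.IsTree} {treeOf p}
      = ENNReal.ofReal (1 / (rootedForests ({ρ} : Finset (Fin n))).card) := by
  classical
  have h1 : {T : SimpleGraph (Fin n) | T.IsTree}
      = ((rootedForests ({ρ} : Finset (Fin n))).image treeOf : Finset _) := by
    rw [Finset.coe_image, image_treeOf]
  have hpos : 0 < (rootedForests ({ρ} : Finset (Fin n))).card := Finset.card_pos.2 ⟨p, hp⟩
  rw [h1, ← Finset.coe_singleton, uniformOn_apply_finset' MeasurableSpace.measurableSet_top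
    MeasurableSpace.measurableSet_top,
    Finset.inter_singleton_of_mem (Finset.mem_image_of_mem _ hp),
    Finset.card_image_of_injOn (treeOf_injOn ρ),
    ENNReal.ofReal_div_of_pos (by exact_mod_cast hpos)]
  simp

theorem uniformOn_univ_singleton (u : Fin n) :
    uniformOn (Set.univ : Set (Fin n)) {u} = ENNReal.ofReal (1 / n) := by
  have hn : (0 : ℝ) < n := by exact_mod_cast u.pos
  rw [uniformOn_univ, Measure.count_singleton, ENNReal.ofReal_div_of_pos hn]
  simp

/-- An event is at most as likely as the average over the trees of its conditional probability. -/
theorem law_le_sum {r : ℝ} (hr : 0 < r) {A : Set (Sample n)}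
    {b : Fin n → (Fin n → Fin n) → Fin n → ℝ}
    (hb : ∀ ρ, ∀ p ∈ rootedForests {ρ}, ∀ u,
      ((clocks (Sym2 (Fin n)) 1).prod (clocks (Sym2 (Fin n)) r)).real
        {x | (treeOf p, x.1, x.2, u, ρ) ∈ A} ≤ b ρ p u) :
    law n r A ≤ ENNReal.ofReal (∑ ρ, ∑ p ∈ rootedForests {ρ}, ∑ u,
      1 / (rootedForests ({ρ} : Finset (Fin n))).card * (1 / n * (1 / n)) * b ρ p u) := by
  have := isProbabilityMeasure_clocks (ι := Sym2 (Fin n)) hr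
  have := isProbabilityMeasure_clocks (ι := Sym2 (Fin n)) one_pos
  set ν := (clocks (Sym2 (Fin n)) 1).prod (clocks (Sym2 (Fin n)) r) with hν
  set υ := (uniformOn (Set.univ : Set (Fin n))).prod (uniformOn (Set.univ : Set (Fin n))) with hυ
  -- The event `A` is arbitrary, so its sections are replaced by measurable hulls of the same
  -- measure.
  set B : Fin n → (Fin n → Fin n) → Fin n → Set ((Sym2 (Fin n) → ℝ) × (Sym2 (Fin n) → ℝ)) :=
    fun ρ p u => toMeasurable ν {x | (treeOf p, x.1, x.2, u, ρ) ∈ A} with hB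
  set C : Fin n → (Fin n → Fin n) → Fin n →
      Set ((Sym2 (Fin n) → ℝ) × (Sym2 (Fin n) → ℝ) × Fin n × Fin n) :=
    fun ρ p u => MeasurableEquiv.prodAssoc.symm ⁻¹' (B ρ p u ×ˢ {(u, ρ)}) with hC
  have hsub : A ⊆ ({T : SimpleGraph (Fin n) | T.IsTree}ᶜ ×ˢ Set.univ) ∪
      ⋃ ρ ∈ (Finset.univ : Finset (Fin n)), ⋃ p ∈ rootedForests {ρ},
        ⋃ u ∈ (Finset.univ : Finset (Fin n)), {treeOf p} ×ˢ C ρ p u := by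
    rintro ⟨T, F, I, u, ρ⟩ hω
    by_cases hT : T.IsTree
    · obtain ⟨p, hp, rfl⟩ := exists_treeOf_eq hT ρ
      refine Or.inr ?_
      simp only [Set.mem_iUnion]
      refine ⟨ρ, Finset.mem_univ _, p, hp, u, Finset.mem_univ _, rfl, ?_, rfl⟩
      exact subset_toMeasurable ν {x | (treeOf p, x.1, x.2, u, ρ) ∈ A} hω
    · exact Or.inl ⟨hT, trivial⟩
  have hnull : law n r ({T : SimpleGraph (Fin n) | T.IsTree}ᶜ ×ˢ Set.univ) = 0 := by
    unfold law
    rw [Measure.prod_prod]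
    have : uniformOn {T : SimpleGraph (Fin n) | T.IsTree} {T : SimpleGraph (Fin n) | T.IsTree}ᶜ
        = 0 := by
      rw [uniformOn, cond_apply MeasurableSpace.measurableSet_top]; simp
    rw [this, zero_mul]
  have hpiece : ∀ ρ, ∀ p ∈ rootedForests {ρ}, ∀ u, law n r ({treeOf p} ×ˢ C ρ p u)
      ≤ ENNReal.ofReal
        (1 / (rootedForests ({ρ} : Finset (Fin n))).card * (1 / n * (1 / n)) * b ρ p u) := by
    intro ρ p hp u
    have h1 : ((clocks (Sym2 (Fin n)) 1).prod ((clocks (Sym2 (Fin n)) r).prod υ)) (C ρ p u)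
        = ν (B ρ p u) * υ {(u, ρ)} := by
      rw [hC, ((measurePreserving_prodAssoc (clocks (Sym2 (Fin n)) 1)
        (clocks (Sym2 (Fin n)) r) υ).symm _).measure_preimage
          ((measurableSet_toMeasurable _ _).prod
            (measurableSet_singleton _)).nullMeasurableSet, Measure.prod_prod]
    have h2 : ν (B ρ p u) ≤ ENNReal.ofReal (b ρ p u) := by
      rw [hB, measure_toMeasurable, ← ofReal_measureReal]
      exact ENNReal.ofReal_le_ofReal (hb ρ p hp u)
    have h3 : υ {(u, ρ)} = ENNReal.ofReal (1 / n * (1 / n)) := by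
      rw [hυ, ← Set.singleton_prod_singleton, Measure.prod_prod, uniformOn_univ_singleton,
        uniformOn_univ_singleton, ENNReal.ofReal_mul (by positivity)]
    have h4 : law n r ({treeOf p} ×ˢ C ρ p u)
        = uniformOn {T : SimpleGraph (Fin n) | T.IsTree} {treeOf p} *
          (ν (B ρ p u) * υ {(u, ρ)}) := by
      rw [← h1]; unfold law; rw [Measure.prod_prod]
    rw [h4, h3, uniformOn_treeOf hp, mul_comm (ν _), ← mul_assoc,
      ENNReal.ofReal_mul (q := b ρ p u) (by positivity),
      ENNReal.ofReal_mul (q := 1 / (n : ℝ) * (1 / n)) (by positivity)]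
    gcongr
  have hb0 : ∀ ρ, ∀ p ∈ rootedForests {ρ}, ∀ u, 0 ≤ b ρ p u := fun ρ p hp u =>
    measureReal_nonneg.trans (hb ρ p hp u)
  refine (measure_mono hsub).trans ((measure_union_le _ _).trans ?_)
  rw [hnull, zero_add]
  have hb1 : ∀ ρ, ∀ p ∈ rootedForests {ρ}, ∀ u ∈ (Finset.univ : Finset (Fin n)), 0 ≤
      1 / (rootedForests ({ρ} : Finset (Fin n))).card * (1 / n * (1 / n)) * b ρ p u :=
    fun ρ p hp u _ => mul_nonneg (by positivity) (hb0 ρ p hp u)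
  rw [ENNReal.ofReal_sum_of_nonneg fun ρ _ => Finset.sum_nonneg fun p hp =>
    Finset.sum_nonneg (hb1 ρ p hp)]
  refine (measure_biUnion_finset_le _ _).trans (Finset.sum_le_sum fun ρ _ => ?_)
  rw [ENNReal.ofReal_sum_of_nonneg fun p hp => Finset.sum_nonneg (hb1 ρ p hp)]
  refine (measure_biUnion_finset_le _ _).trans (Finset.sum_le_sum fun p hp => ?_)
  rw [ENNReal.ofReal_sum_of_nonneg (hb1 ρ p hp)]
  exact (measure_biUnion_finset_le _ _).trans (Finset.sum_le_sum fun u _ => hpiece ρ p hp u)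

theorem sum_univ_eq_sum_level {V : Type*} [Fintype V] [DecidableEq V] {ρ : V} {p : V → V}
    (hp : p ∈ rootedForests {ρ}) (f : V → ℝ) :
    ∑ u, f u = ∑ k ∈ Finset.range (Fintype.card V), ∑ u ∈ level {ρ} p ρ k, f u := by
  have hlev : ∀ u k, u ∈ level {ρ} p ρ k ↔ (pathAbove {ρ} p u).card = k := by
    intro u k
    constructor
    · exact card_pathAbove hp (Finset.mem_singleton_self ρ)
    · rintro rfl
      obtain ⟨k, q, hq, hk⟩ := exists_mem_level hp u
      rw [card_pathAbove hp hq hk]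
      rwa [Finset.mem_singleton.1 hq] at hk
  rw [← Finset.sum_fiberwise_of_maps_to (g := fun u => (pathAbove {ρ} p u).card)
    (t := Finset.range (Fintype.card V))]
  · refine Finset.sum_congr rfl fun k _ => Finset.sum_congr ?_ fun _ _ => rfl
    ext u; simp [hlev]
  · intro u _
    rw [Finset.mem_range]
    refine Finset.card_lt_univ_of_notMem (x := ρ) fun h => (mem_pathAbove.1 h).1 ?_
    exact Finset.mem_singleton_self ρ

theorem const_mem_rootedForests {V : Type*} [Fintype V] [DecidableEq V] (ρ : V) :
    (fun _ => ρ) ∈ rootedForests ({ρ} : Finset V) :=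
  mem_rootedForests.2 ⟨fun _ ha => (Finset.mem_singleton.1 ha).symm, fun _ => ⟨1, by simp⟩⟩

/-- Averaging over the trees and the two vertices a function of the path between the vertices and
of the forest that hangs off it. -/
theorem law_le {r : ℝ} (hr : 0 < r) (hn : 0 < n) {A : Set (Sample n)}
    {Ξ : Finset (Fin n) → (Fin n → Fin n) → ℝ} {B : ℕ → ℝ}
    (hΞ : ∀ ρ, ∀ p ∈ rootedForests {ρ}, ∀ u,
      ((clocks (Sym2 (Fin n)) 1).prod (clocks (Sym2 (Fin n)) r)).real
        {x | (treeOf p, x.1, x.2, u, ρ) ∈ A}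
          ≤ Ξ (addOrbit {ρ} p u) (freeze p (addOrbit {ρ} p u)))
    (hB : ∀ Q : Finset (Fin n), Q.Nonempty →
      ∑ h ∈ rootedForests Q, Ξ Q h ≤ (rootedForests Q).card * B Q.card) :
    law n r A ≤ ENNReal.ofReal (∑ k ∈ Finset.range n,
      ((k + 1 : ℕ) : ℝ) / n * distinctProb n (k + 1) * B (k + 1)) := by
  have hnR : (n : ℝ) ≠ 0 := by positivity
  refine (law_le_sum hr hΞ).trans (ENNReal.ofReal_le_ofReal ?_)
  have h1 : ∀ ρ : Fin n, ∑ p ∈ rootedForests {ρ}, ∑ u,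
      1 / (rootedForests ({ρ} : Finset (Fin n))).card * (1 / n * (1 / n))
        * Ξ (addOrbit {ρ} p u) (freeze p (addOrbit {ρ} p u))
      ≤ ∑ k ∈ Finset.range n, 1 / n * (1 / n) * (levelMean n 1 k * B (k + 1)) := by
    intro ρ
    set τ : ℝ := ((rootedForests ({ρ} : Finset (Fin n))).card : ℝ) with hτ
    simp_rw [← Finset.mul_sum]
    rw [Finset.sum_congr rfl fun p hp => sum_univ_eq_sum_level hp _, Finset.sum_comm,
      Fintype.card_fin]
    have h2 : ∀ k ∈ Finset.range n, ∑ p ∈ rootedForests {ρ}, ∑ u ∈ level {ρ} p ρ k,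
        Ξ (addOrbit {ρ} p u) (freeze p (addOrbit {ρ} p u)) ≤ τ * (levelMean n 1 k * B (k + 1)) := by
      intro k _
      -- Freezing the path from `u` at depth `k` leaves a uniform forest with `k + 1` roots.
      have h3 := sumLevel_le (P := {ρ}) (q := ρ) (Finset.mem_singleton_self ρ) (k := k) (Ξ := Ξ)
        (B := B (k + 1)) fun Q hQ hc => by
          have := hB Q ⟨ρ, hQ (Finset.mem_singleton_self ρ)⟩
          rwa [hc, Finset.card_singleton, add_comm 1 k] at this
      rwa [Finset.card_singleton, Fintype.card_fin] at h3
    have h0 : 0 < τ := by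
      rw [hτ, Nat.cast_pos]
      exact Finset.card_pos.2 ⟨fun _ => ρ, const_mem_rootedForests ρ⟩
    calc 1 / τ * (1 / n * (1 / n)) * ∑ k ∈ Finset.range n, ∑ p ∈ rootedForests {ρ},
          ∑ u ∈ level {ρ} p ρ k, Ξ (addOrbit {ρ} p u) (freeze p (addOrbit {ρ} p u))
        ≤ 1 / τ * (1 / n * (1 / n)) * ∑ k ∈ Finset.range n, τ * (levelMean n 1 k * B (k + 1)) :=
          mul_le_mul_of_nonneg_left (Finset.sum_le_sum h2) (by positivity)
      _ = _ := by
          rw [← Finset.mul_sum, ← mul_assoc]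
          congr 1
          have : τ ≠ 0 := h0.ne'
          field_simp
  refine (Finset.sum_le_sum fun ρ _ => h1 ρ).trans (le_of_eq ?_)
  rw [Finset.sum_const, Finset.card_univ, Fintype.card_fin, nsmul_eq_mul, Finset.mul_sum]
  refine Finset.sum_congr rfl fun k _ => ?_
  rw [← levelMean_one hn]
  field_simp

end Average

/-! ### The two regimes -/

section Limits

variable {n : ℕ}

/-- By `distinctProb_add` the sum is dominated by a shifted piece of `∑ m ^ 2 / n * distinctProb n
m`. The bound does not depend on `k`, so summing over depths with weights `1 / k` costs only a
harmonic sum. -/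
theorem sum_distinctProb_mul_levelMean_le (hn : 0 < n) (k : ℕ) :
    ∑ j ∈ Finset.range n, ((j + 1 : ℕ) : ℝ) / n * distinctProb n (j + 1)
      * (((j + 1 : ℕ) : ℝ) * levelMean n (j + 1) k) ≤ 2 * √n := by
  have hnR : (0 : ℝ) < n := by exact_mod_cast hn
  have h1 := sum_sq_distinctProb_le hn (k + 1 + n)
  rw [Finset.sum_range_add] at h1
  have h2 : 0 ≤ ∑ m ∈ Finset.range (k + 1), ((m : ℝ) ^ 2 / n * distinctProb n m) :=
    Finset.sum_nonneg fun m _ => mul_nonneg (by positivity) (distinctProb_nonneg n m)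
  refine le_trans (Finset.sum_le_sum fun j _ => ?_) ((le_add_of_nonneg_left h2).trans h1)
  have h3 := distinctProb_add (n := n) (m := j + 1) (k := k) (by omega)
  rw [mul_assoc, h3, show j + 1 + k = k + 1 + j by ring]
  have h4 := distinctProb_nonneg n (k + 1 + j)
  have h5 : (((j + 1 : ℕ) : ℝ)) ≤ ((k + 1 + j : ℕ) : ℝ) := by
    exact_mod_cast (by omega : j + 1 ≤ k + 1 + j)
  have h6 : (((j + 1 : ℕ) : ℝ) + k) = ((k + 1 + j : ℕ) : ℝ) := by push_cast; ring
  rw [h6]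
  calc ((j + 1 : ℕ) : ℝ) / n * (((k + 1 + j : ℕ) : ℝ) * distinctProb n (k + 1 + j))
      ≤ ((k + 1 + j : ℕ) : ℝ) / n * (((k + 1 + j : ℕ) : ℝ) * distinctProb n (k + 1 + j)) := by
        gcongr
    _ = _ := by ring

theorem law_compl_connectedEvent_le (hn : 0 < n) {r : ℝ} (hr : 0 < r) :
    law n r (connectedEvent n)ᶜ ≤ ENNReal.ofReal (r * (2 * √n * (1 + harmonicSum n))) := by
  refine (law_le hr hn (Ξ := fun P h => r * fireMean P h)
    (B := fun m => r * (m + ∑ k ∈ Finset.Icc 1 n, (1 / k : ℝ) * (m * levelMean n m k)))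
    (fun ρ p hp u => clocks_not_sameComponent_le hp u hr) ?_).trans (ENNReal.ofReal_le_ofReal ?_)
  · intro Q _
    unfold fireMean
    rw [← Finset.mul_sum, Finset.sum_add_distrib, Finset.sum_comm, Fintype.card_fin]
    apply le_of_eq
    have h1 : ∀ k ∈ Finset.Icc 1 n, ∑ h ∈ rootedForests Q, (1 / k : ℝ) *
        ∑ q ∈ Q, ((level Q h q k).card : ℝ)
        = (rootedForests Q).card * ((1 / k : ℝ) * (Q.card * levelMean n Q.card k)) := by
      intro k _
      rw [← Finset.mul_sum, Finset.sum_comm, Finset.sum_congr rfl fun q hq => sum_card_level hq k,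
        Finset.sum_const, nsmul_eq_mul, Fintype.card_fin]
      ring
    rw [Finset.sum_congr rfl h1, ← Finset.mul_sum, Finset.sum_const, nsmul_eq_mul]
    ring
  · have h1 : ∀ j ∈ Finset.range n, ((j + 1 : ℕ) : ℝ) / n * distinctProb n (j + 1) *
        (r * (((j + 1 : ℕ) : ℝ) + ∑ k ∈ Finset.Icc 1 n, (1 / k : ℝ) *
          (((j + 1 : ℕ) : ℝ) * levelMean n (j + 1) k)))
        = r * ((((j + 1 : ℕ) : ℝ) ^ 2 / n * distinctProb n (j + 1))
          + ∑ k ∈ Finset.Icc 1 n, (1 / k : ℝ) * (((j + 1 : ℕ) : ℝ) / n * distinctProb n (j + 1) *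
            (((j + 1 : ℕ) : ℝ) * levelMean n (j + 1) k))) := by
      intro j _
      rw [mul_left_comm, mul_add, Finset.mul_sum]
      congr 2
      · ring
      · exact Finset.sum_congr rfl fun k _ => by ring
    rw [Finset.sum_congr rfl h1, ← Finset.mul_sum, Finset.sum_add_distrib, Finset.sum_comm]
    refine mul_le_mul_of_nonneg_left ?_ hr.le
    have h2 : ∑ j ∈ Finset.range n, (((j + 1 : ℕ) : ℝ) ^ 2 / n * distinctProb n (j + 1))
        ≤ 2 * √n := by
      have := sum_sq_distinctProb_le hn (n + 1)
      rw [Finset.sum_range_succ'] at this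
      simpa using this
    have h3 : ∑ k ∈ Finset.Icc 1 n, ∑ j ∈ Finset.range n, (1 / k : ℝ) *
        (((j + 1 : ℕ) : ℝ) / n * distinctProb n (j + 1) *
            (((j + 1 : ℕ) : ℝ) * levelMean n (j + 1) k)) ≤ harmonicSum n * (2 * √n) := by
      unfold harmonicSum
      rw [Finset.sum_mul]
      refine Finset.sum_le_sum fun k _ => ?_
      rw [← Finset.mul_sum]
      exact mul_le_mul_of_nonneg_left (sum_distinctProb_mul_levelMean_le hn k) (by positivity)
    calc _ ≤ 2 * √n + harmonicSum n * (2 * √n) := add_le_add h2 h3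
      _ = _ := by ring

theorem one_le_harmonicSum {K : ℕ} (hK : 1 ≤ K) : 1 ≤ harmonicSum K := by
  unfold harmonicSum
  have := Finset.single_le_sum (f := fun k : ℕ => (1 / k : ℝ)) (s := Finset.Icc 1 K)
    (fun _ _ => by positivity) (Finset.mem_Icc.2 ⟨le_rfl, hK⟩)
  simpa using this

/-- The constant in the bound for the connection probability in the critical case. -/
noncomputable def criticalConstant (K : ℕ) : ℝ :=
  8 * K + 8 * K ^ 2 * (K + 1) ^ 4 + 8 * K * (K + 1)

/-- Uses `harmonicSum K ≥ 1` to drop the powers of the harmonic sum, and `m + K ≤ (K + 1) * m`. -/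
theorem deviation_bound_le {K m : ℕ} (hK : 1 ≤ K) (hm : 1 ≤ m) (hn : 0 < n) :
    4 / (m * harmonicSum K) ^ 2 * (2 * K * m * harmonicSum K ^ 2 + 2 * K ^ 2 * (K + 1) ^ 4 * m
        + 2 * m ^ 2 * harmonicSum K ^ 2 * (K * (m + K) / n))
      ≤ criticalConstant K * (1 / m + m / n) := by
  have hH := one_le_harmonicSum hK
  set H := harmonicSum K
  have hmR : (1 : ℝ) ≤ m := by exact_mod_cast hm
  have hKR : (1 : ℝ) ≤ K := by exact_mod_cast hK
  have hnR : (0 : ℝ) < n := by exact_mod_cast hn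
  have hH0 : 0 < H := by linarith
  have hm0 : (0 : ℝ) < m := by linarith
  have e : 4 / (m * H) ^ 2 * (2 * K * m * H ^ 2 + 2 * K ^ 2 * (K + 1) ^ 4 * m
        + 2 * m ^ 2 * H ^ 2 * (K * (m + K) / n))
      = 8 * K * (1 / m) + 8 * K ^ 2 * (K + 1) ^ 4 * (1 / (m * H ^ 2))
        + 8 * K * ((m + K) / n) := by
    field_simp
    norm_num
  rw [e]
  have h1 : 1 / (m * H ^ 2) ≤ 1 / m := by
    refine one_div_le_one_div_of_le hm0 ?_
    nlinarith [mul_nonneg hm0.le (by nlinarith : 0 ≤ H ^ 2 - 1)]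
  have h2 : ((m : ℝ) + K) / n ≤ (K + 1) * (m / n) := by
    rw [← mul_div_assoc]; gcongr; nlinarith
  have h3 : (0 : ℝ) ≤ 1 / m := by positivity
  have h4 : (0 : ℝ) ≤ m / n := by positivity
  have hK0 : (0 : ℝ) ≤ K := by linarith
  calc _ ≤ 8 * K * (1 / m) + 8 * K ^ 2 * (K + 1) ^ 4 * (1 / m)
        + 8 * K * ((K + 1) * (m / n : ℝ)) := by gcongr
    _ ≤ (8 * K + 8 * K ^ 2 * (K + 1) ^ 4) * (1 / m + m / n)
        + 8 * K * (K + 1) * (1 / m + m / n : ℝ) := by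
        have h5 : (0 : ℝ) ≤ (8 * K + 8 * K ^ 2 * (K + 1) ^ 4) * (m / n) := by positivity
        have h6 : (0 : ℝ) ≤ 8 * K * (K + 1) * (1 / m) := by positivity
        linarith
    _ = _ := by unfold criticalConstant; ring

/-- The exponential term gives `4 / harmonicSum K`. The deviation is of relative size `1 / m + m /
n`, which the law of the path length averages to order `1 / √n`. -/
theorem law_connectedEvent_le (hn : 0 < n) {K : ℕ} (hK : 1 ≤ K) :
    law n (1 / √n) (connectedEvent n)
      ≤ ENNReal.ofReal (4 / harmonicSum K + 4 * criticalConstant K / √n) := by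
  have hH := one_le_harmonicSum hK
  have hH0 : 0 < harmonicSum K := by linarith
  have hnR : (0 : ℝ) < n := by exact_mod_cast hn
  have hs : 0 < √(n : ℝ) := Real.sqrt_pos.2 hnR
  have hss : √(n : ℝ) * √n = n := Real.mul_self_sqrt hnR.le
  have hr : 0 < 1 / √(n : ℝ) := by positivity
  have hC : 0 ≤ criticalConstant K := by unfold criticalConstant; positivity
  refine (law_le hr hn
    (Ξ := fun P h => Real.exp (-(1 / √n * (P.card * harmonicSum K) / 2))
      + 4 / (P.card * harmonicSum K) ^ 2 * deviation K P h)
    (B := fun m => Real.exp (-(1 / √n * (m * harmonicSum K) / 2))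
      + 4 / (m * harmonicSum K) ^ 2 * (2 * K * m * harmonicSum K ^ 2
        + 2 * K ^ 2 * (K + 1) ^ 4 * m + 2 * m ^ 2 * harmonicSum K ^ 2 * (K * (m + K) / n)))
    (fun ρ p hp u => clocks_sameComponent_le hp u hr hH0) ?_).trans
      (ENNReal.ofReal_le_ofReal ?_)
  · intro Q hQ
    rw [Finset.sum_add_distrib, Finset.sum_const, nsmul_eq_mul, ← Finset.mul_sum, mul_add]
    have h1 := sum_deviation_le K hQ
    rw [Fintype.card_fin] at h1
    have h2 := mul_le_mul_of_nonneg_left h1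
      (by positivity : (0 : ℝ) ≤ 4 / (Q.card * harmonicSum K) ^ 2)
    linarith
  · have h1 : ∀ j ∈ Finset.range n, ((j + 1 : ℕ) : ℝ) / n * distinctProb n (j + 1) *
        (Real.exp (-(1 / √n * (((j + 1 : ℕ) : ℝ) * harmonicSum K) / 2))
          + 4 / (((j + 1 : ℕ) : ℝ) * harmonicSum K) ^ 2
            * (2 * K * ((j + 1 : ℕ) : ℝ) * harmonicSum K ^ 2
              + 2 * K ^ 2 * (K + 1) ^ 4 * ((j + 1 : ℕ) : ℝ)
              + 2 * ((j + 1 : ℕ) : ℝ) ^ 2 * harmonicSum K ^ 2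
                * (K * (((j + 1 : ℕ) : ℝ) + K) / n)))
        ≤ (2 / (√n * harmonicSum K) + criticalConstant K / n) * distinctProb n (j + 1)
          + criticalConstant K / n * (((j + 1 : ℕ) : ℝ) ^ 2 / n * distinctProb n (j + 1)) := by
      intro j _
      have h2 := deviation_bound_le (n := n) hK (Nat.le_add_left 1 j) hn
      have h3 := distinctProb_nonneg n (j + 1)
      have hm0 : (0 : ℝ) < ((j + 1 : ℕ) : ℝ) := by positivity
      generalize ((j + 1 : ℕ) : ℝ) = m at h2 hm0 ⊢
      -- The bound `exp (-x) ≤ 1 / x` also covers short paths: the factor `1 / m` cancels the weight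
      -- `m` of the law of the path length.
      have h4 : Real.exp (-(1 / √n * (m * harmonicSum K) / 2)) ≤
          2 * √n / (m * harmonicSum K) := by
        have h5 : 0 < 1 / √n * (m * harmonicSum K) / 2 := by positivity
        have h6 : Real.exp (-(1 / √n * (m * harmonicSum K) / 2))
            ≤ (1 / √n * (m * harmonicSum K) / 2)⁻¹ := by
          rw [Real.exp_neg]
          refine inv_anti₀ h5 ?_
          linarith [Real.add_one_le_exp (1 / √n * (m * harmonicSum K) / 2)]
        refine h6.trans (le_of_eq ?_)
        field_simp
      calc _ ≤ m / n * distinctProb n (j + 1) * (2 * √n / (m * harmonicSum K)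
            + criticalConstant K * (1 / m + m / n)) := by gcongr
        _ = _ := by
          have h7 : m / n * (2 * √n / (m * harmonicSum K)) = 2 / (√n * harmonicSum K) := by
            generalize √(n : ℝ) = s at hs hss ⊢
            rw [← hss]; field_simp
          have h8 : m / n * (criticalConstant K * (1 / m + m / n))
              = criticalConstant K / n + criticalConstant K / n * (m ^ 2 / n) := by
            field_simp
          calc _ = (m / n * (2 * √n / (m * harmonicSum K))
              + m / n * (criticalConstant K * (1 / m + m / n))) * distinctProb n (j + 1) := by ring
            _ = _ := by rw [h7, h8]; ring
    refine (Finset.sum_le_sum h1).trans ?_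
    rw [Finset.sum_add_distrib, ← Finset.mul_sum, ← Finset.mul_sum]
    have h2 := sum_distinctProb_le hn n
    have h3 : ∑ j ∈ Finset.range n, (((j + 1 : ℕ) : ℝ) ^ 2 / n * distinctProb n (j + 1))
        ≤ 2 * √n := by
      have := sum_sq_distinctProb_le hn (n + 1)
      rw [Finset.sum_range_succ'] at this
      simpa using this
    calc _ ≤ (2 / (√n * harmonicSum K) + criticalConstant K / n) * (2 * √n)
          + criticalConstant K / n * (2 * √n) := by gcongr
      _ = 4 / harmonicSum K + 4 * criticalConstant K / √n := by
          have h4 : criticalConstant K / n * (2 * √n) = 2 * criticalConstant K / √n := by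
            generalize √(n : ℝ) = s at hs hss ⊢
            rw [← hss]; field_simp
          have h5 : 2 / (√n * harmonicSum K) * (2 * √n) = 4 / harmonicSum K := by
            field_simp; norm_num
          rw [add_mul, h5, h4]; ring

theorem tendsto_harmonicSum : Tendsto harmonicSum atTop atTop := by
  refine tendsto_atTop_mono (f := fun K : ℕ => Real.log (K + 1)) (fun K => ?_) ?_
  · rw [harmonicSum_eq]
    exact_mod_cast log_add_one_le_harmonic K
  · exact Real.tendsto_log_atTop.comp
      (tendsto_atTop_add_const_right _ _ tendsto_natCast_atTop_atTop)

theorem tendsto_supercritical_bound {α : ℝ} (hα : 1 / 2 < α) :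
    Tendsto (fun n : ℕ => (n : ℝ) ^ (-α) * (2 * √n * (1 + harmonicSum n))) atTop (𝓝 0) := by
  set δ := α - 1 / 2 with hδ
  have hδ0 : 0 < δ := by linarith
  have h1 : Tendsto (fun x : ℝ => 2 * (2 * x ^ (-δ) + x ^ (-δ) * Real.log x)) atTop (𝓝 0) := by
    have h2 := tendsto_rpow_neg_atTop hδ0
    have h3 : Tendsto (fun x : ℝ => x ^ (-δ) * Real.log x) atTop (𝓝 0) := by
      have := (isLittleO_log_rpow_atTop hδ0).tendsto_div_nhds_zero
      refine this.congr' ?_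
      filter_upwards [eventually_gt_atTop 0] with x hx
      rw [Real.rpow_neg hx.le, div_eq_inv_mul]
    simpa using ((h2.const_mul 2).add h3).const_mul 2
  have h4 := h1.comp tendsto_natCast_atTop_atTop (α := ℕ)
  refine squeeze_zero' (Eventually.of_forall fun n => ?_) ?_ h4
  · have := harmonicSum_nonneg n
    positivity
  · filter_upwards [eventually_gt_atTop 0] with n hn
    have hnR : (0 : ℝ) < n := by exact_mod_cast hn
    have h5 : harmonicSum n ≤ 1 + Real.log n := by
      rw [harmonicSum_eq]; exact harmonic_le_one_add_log n
    have h6 : (n : ℝ) ^ (-α) * √n = (n : ℝ) ^ (-δ) := by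
      rw [Real.sqrt_eq_rpow, ← Real.rpow_add hnR]
      congr 1; rw [hδ]; ring
    have h7 : 0 ≤ (n : ℝ) ^ (-δ) := by positivity
    calc (n : ℝ) ^ (-α) * (2 * √n * (1 + harmonicSum n))
        = 2 * ((n : ℝ) ^ (-α) * √n) * (1 + harmonicSum n) := by ring
      _ ≤ 2 * (n : ℝ) ^ (-δ) * (1 + (1 + Real.log n)) := by rw [h6]; gcongr
      _ = _ := by simp only [Function.comp]; ring

theorem isProbabilityMeasure_law (hn : 0 < n) {r : ℝ} (hr : 0 < r) :
    IsProbabilityMeasure (law n r) := by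
  have := isProbabilityMeasure_clocks (ι := Sym2 (Fin n)) hr
  have := isProbabilityMeasure_clocks (ι := Sym2 (Fin n)) one_pos
  have : Nonempty (Fin n) := ⟨⟨0, hn⟩⟩
  have h1 : {T : SimpleGraph (Fin n) | T.IsTree}.Nonempty :=
    ⟨_, treeOf_isTree (const_mem_rootedForests ⟨0, hn⟩)⟩
  have := isProbabilityMeasure_uniformOn' (Set.toFinite {T : SimpleGraph (Fin n) | T.IsTree}) h1
    MeasurableSpace.measurableSet_top
  unfold law
  infer_instance

theorem tendsto_law_supercritical {α : ℝ} (hα : 1 / 2 < α) :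
    Tendsto (fun n : ℕ => law n ((n : ℝ) ^ (-α)) (connectedEvent n)) atTop (𝓝 1) := by
  have h1 : Tendsto (fun n : ℕ => 1 - ENNReal.ofReal
      ((n : ℝ) ^ (-α) * (2 * √n * (1 + harmonicSum n)))) atTop (𝓝 1) := by
    have := ENNReal.Tendsto.sub (tendsto_const_nhds (x := (1 : ENNReal)))
      (ENNReal.tendsto_ofReal (tendsto_supercritical_bound hα)) (Or.inl ENNReal.one_ne_top)
    simpa using this
  refine tendsto_of_tendsto_of_tendsto_of_le_of_le' h1 tendsto_const_nhds ?_ ?_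
  · filter_upwards [eventually_gt_atTop 0] with n hn
    have hr : 0 < (n : ℝ) ^ (-α) := Real.rpow_pos_of_pos (by exact_mod_cast hn) _
    have := isProbabilityMeasure_law hn hr
    rw [tsub_le_iff_right]
    calc (1 : ENNReal) = law n ((n : ℝ) ^ (-α)) Set.univ := measure_univ.symm
      _ ≤ law n ((n : ℝ) ^ (-α)) (connectedEvent n)
          + law n ((n : ℝ) ^ (-α)) (connectedEvent n)ᶜ := by
            rw [← Set.union_compl_self (connectedEvent n)]; exact measure_union_le _ _
      _ ≤ _ := by gcongr; exact law_compl_connectedEvent_le hn hr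
  · filter_upwards [eventually_gt_atTop 0] with n hn
    have hr : 0 < (n : ℝ) ^ (-α) := Real.rpow_pos_of_pos (by exact_mod_cast hn) _
    have := isProbabilityMeasure_law hn hr
    exact prob_le_one

theorem tendsto_law_critical :
    Tendsto (fun n : ℕ => law n ((n : ℝ) ^ (-(1 / 2 : ℝ))) (connectedEvent n)) atTop (𝓝 0) := by
  have hrate : ∀ n : ℕ, (n : ℝ) ^ (-(1 / 2 : ℝ)) = 1 / √n := fun n => by
    rw [Real.rpow_neg (Nat.cast_nonneg n), Real.sqrt_eq_rpow]
    exact (one_div _).symm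
  have key : ∀ ε : ℝ, 0 < ε → ∀ᶠ n : ℕ in atTop,
      law n ((n : ℝ) ^ (-(1 / 2 : ℝ))) (connectedEvent n) ≤ ENNReal.ofReal ε := by
    intro ε hε
    have h1 : Tendsto (fun K => 4 / harmonicSum K) atTop (𝓝 0) :=
      tendsto_harmonicSum.const_div_atTop 4
    -- The depth `K` is fixed before `n` grows, because `criticalConstant K` is not bounded in `K`.
    obtain ⟨K, hK1, hK⟩ := ((eventually_ge_atTop 1).and
      (h1.eventually_lt_const (half_pos hε))).exists
    have h2 : Tendsto (fun n : ℕ => 4 * criticalConstant K / √(n : ℝ)) atTop (𝓝 0) :=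
      (Real.tendsto_sqrt_atTop.comp tendsto_natCast_atTop_atTop).const_div_atTop _
    filter_upwards [h2.eventually_lt_const (half_pos hε), eventually_gt_atTop 0] with n hn hn0
    rw [hrate]
    exact (law_connectedEvent_le hn0 hK1).trans (ENNReal.ofReal_le_ofReal (by linarith))
  rw [ENNReal.tendsto_nhds_zero]
  intro ε hε
  obtain ⟨x, hx0, hx⟩ := ENNReal.lt_iff_exists_nnreal_btwn.1 hε
  have hx0' : 0 < (x : ℝ) := by exact_mod_cast hx0
  filter_upwards [key x hx0'] with n hn
  refine hn.trans ?_
  rw [ENNReal.ofReal_coe_nnreal]; exact hx.le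

end Limits

end FireForest

theorem theorem2 :
    (∀ α : ℝ, 1 / 2 < α →
      Tendsto (fun n : ℕ => FireForest.law n ((n : ℝ) ^ (-α)) (FireForest.connectedEvent n))
        atTop (𝓝 1)) ∧
    (∀ α : ℝ, α = 1 / 2 →
      Tendsto (fun n : ℕ => FireForest.law n ((n : ℝ) ^ (-α)) (FireForest.connectedEvent n))
        atTop (𝓝 0)) := by
  refine ⟨fun α hα => FireForest.tendsto_law_supercritical hα, ?_⟩
  rintro α rfl
  exact FireForest.tendsto_law_critical
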